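/- Let $\mathbb{K}$ be a field of characteristic zero and let $V$ be a finite set with $|V|=\ell\ge 2$. A (hyperplane) arrangement in $\mathbb{K}^W$ ($W$ a finite set) is a finite set of affine hyperplanes; it is central if all of them contain the origin. For a hyperplane $H$ let $\alpha_H$ be a polynomial of degree $1$ whose zero set is $H$. A central arrangement $\mathscr{A}$ in $\mathbb{K}^W$ is free if $$D(\mathscr{A})=\Big\{\theta\in\sum_{i\in W}S\,\partial_i\ \Big|\ \theta(\alpha_H)\in\alpha_H S\text{ for all }H\in\mathscr{A}\Big\},\qquad S=\mathbb{K}[x_i\mid i\in W],$$ is a free $S$-module, and it is free with multiset of exponents $\exp(\mathscr{A})=\{d_i\}_{i\in W}$ if $D(\mathscr{A})$ has an $S$-basis $(\theta_i)_{i\in W}$ with $\theta_i$ homogeneous of degree $d_i$ (all its coefficients are zero or homogeneous polynomials of degree $d_i$). For $H\in\mathscr{A}$ let $\mathscr{A}^H=\{H'\cap H\mid H'\in\mathscr{A},\ H\not\subseteq H',\ H'\cap H\ne\emptyset\}$, an arrangement in the vector space $H$. The class of inductively free arrangements is the smallest class of central arrangements that contains the empty arrangements and contains $\mathscr{A}$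 whenever, for some $H\in\mathscr{A}$, it contains $\mathscr{A}\setminus\{H\}$ and $\mathscr{A}^H$ and $\exp(\mathscr{A}^H)\subseteq\exp(\mathscr{A}\setminus\{H\})$ as multisets. The cone of an arrangement $\mathscr{A}$ in $\mathbb{K}^V$ is the central arrangement $$c\mathscr{A}=\{\{z=0\}\}\cup\{\{\alpha_H(x)+\alpha_H(0)(z-1)=0\}\mid H\in\mathscr{A}\}$$ in $\mathbb{K}^{V}\times\mathbb{K}$, with $z$ the additional coordinate. For $n=(n_i)_{i\in V}\in\mathbb{Z}_{\ge 0}^V$ and a digraph $G=(V,E)$ put $|n|=\sum_{i\in V}n_i$, let $\varepsilon_G(i,j)=1$ if $(i,j)\in E$ and $\varepsilon_G(i,j)=0$ otherwise, and let $$\mathscr{A}(n,G)=\{\{x_i-x_j=c\}\mid i,j\in V,\ i\ne j,\ c\in\mathbb{Z},\ -n_i-\varepsilon_G(i,j)\le c\le n_j+\varepsilon_G(j,i)\}.$$ Theorem. If $E=\emptyset$, then $c\mathscr{A}(n,G)$ is free with exponents $\{0,1,|n|+1,|n|+2,\dots,|n|+\ell-1\}$, and it is inductively free. In particular, for every integer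 $m\ge 0$, the cone of the extended Catalan arrangement of type A, $\{\{x_i-x_j=c\}\mid i,j\in V,\ i\ne j,\ c\in\mathbb{Z},\ -m\le c\le m\}$, is free. -/

import Mathlib

open MvPolynomial

namespace HyperplaneArrangement

universe u v

/-- `p` is a defining polynomial of the affine hyperplane `H` of `K^ι`: it has degree one and `H` is
its zero set. -/
def IsDefiningPolynomial {K : Type v} [Field K] {ι : Type u}
    (p : MvPolynomial ι K) (H : Set (ι → K)) : Prop :=
  p.totalDegree = 1 ∧ H = {x | eval x p = 0}

/-- An arrangement in `K^ι` is a finite set of affine hyperplanes. -/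
structure IsArrangement {K : Type v} [Field K] {ι : Type u} (A : Set (Set (ι → K))) : Prop where
  finite : A.Finite
  isHyperplane : ∀ H ∈ A, ∃ p : MvPolynomial ι K, IsDefiningPolynomial p H

/-- An arrangement is central if all its hyperplanes contain the origin. -/
structure IsCentralArrangement {K : Type v} [Field K] {ι : Type u}
    (A : Set (Set (ι → K))) : Prop extends IsArrangement A where
  zero_mem : ∀ H ∈ A, (0 : ι → K) ∈ H

/-- The module `D(A)` of logarithmic derivations: all derivations `θ` of the polynomial ring `S`
such that `θ(α_H) ∈ α_H S` for every hyperplane `H ∈ A`. (The defining polynomial `α_H` is unique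
up to a nonzero scalar, so it does not matter that all of them are tested.) -/
def logDerivations {K : Type v} [Field K] {ι : Type u} (A : Set (Set (ι → K))) :
    Submodule (MvPolynomial ι K) (Derivation K (MvPolynomial ι K) (MvPolynomial ι K)) where
  carrier := {θ | ∀ H ∈ A, ∀ p : MvPolynomial ι K, IsDefiningPolynomial p H → p ∣ θ p}
  zero_mem' := fun _ _ p _ => by simp
  add_mem' := fun ha hb H hH p hp => by
    simpa using dvd_add (ha H hH p hp) (hb H hH p hp)
  smul_mem' := fun c _ ha H hH p hp => by
    simpa using Dvd.dvd.mul_left (ha H hH p hp) c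

/-- `A` is free if `D(A)` is a free module over the polynomial ring. -/
def IsFree {K : Type v} [Field K] {ι : Type u} (A : Set (Set (ι → K))) : Prop :=
  Module.Free (MvPolynomial ι K) (logDerivations A)

/-- A derivation `∑ f_i ∂_i` is homogeneous of degree `d` if each `f_i` is zero or homogeneous of
degree `d`. -/
def IsHomogeneousDerivation {K : Type v} [Field K] {ι : Type u}
    (θ : Derivation K (MvPolynomial ι K) (MvPolynomial ι K)) (d : ℕ) : Prop :=
  ∀ i : ι, (θ (X i)).IsHomogeneous d

/-- `A` is free with multiset of exponents `e`: the module `D(A)` has a homogeneous basis whose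
degrees form the multiset `e`. -/
def IsFreeWithExponents {K : Type v} [Field K] {ι : Type u} [Fintype ι]
    (A : Set (Set (ι → K))) (e : Multiset ℕ) : Prop :=
  ∃ (b : Module.Basis ι (MvPolynomial ι K) (logDerivations A)) (d : ι → ℕ),
    (∀ i, IsHomogeneousDerivation (b i).1 (d i)) ∧ (Finset.univ : Finset ι).val.map d = e

/-- The restriction `A^X = {H ∩ X | H ∈ A, X ⊈ H, H ∩ X ≠ ∅}`, a set of subsets of `X`. -/
def restriction {K : Type v} {ι : Type u} (A : Set (Set (ι → K))) (X : Set (ι → K)) :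
    Set (Set (ι → K)) :=
  {Y | ∃ H ∈ A, ¬ X ⊆ H ∧ (H ∩ X).Nonempty ∧ Y = H ∩ X}

/-- The class of inductively free arrangements: the smallest class of central arrangements that
contains the empty arrangements and contains `A` as soon as, for some `H ∈ A`, it contains
`A \ {H}` and `A^H` and `exp(A^H) ⊆ exp(A \ {H})` (as multisets). Here `A^H` is an arrangement in
the vector space `H`; it is viewed in a coordinate space `K^κ` through a linear isomorphism `φ` of
`K^κ` onto `H`. -/
inductive IsInductivelyFree {K : Type v} [Field K] :
    ∀ {ι : Type u} [Fintype ι], Set (Set (ι → K)) → Prop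
  | empty {ι : Type u} [Fintype ι] : IsInductivelyFree (∅ : Set (Set (ι → K)))
  | add {ι κ : Type u} [Fintype ι] [Fintype κ] (A : Set (Set (ι → K)))
      (hA : IsCentralArrangement A) (H : Set (ι → K)) (hH : H ∈ A)
      (φ : (κ → K) →ₗ[K] (ι → K)) (hφ : Function.Injective φ) (hφH : Set.range φ = H)
      (e e' : Multiset ℕ)
      (hdel : IsInductivelyFree (A \ {H}))
      (hres : IsInductivelyFree ((fun Y : Set (ι → K) => φ ⁻¹' Y) '' restriction A H))
      (he : IsFreeWithExponents (A \ {H}) e)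
      (he' : IsFreeWithExponents ((fun Y : Set (ι → K) => φ ⁻¹' Y) '' restriction A H) e')
      (hle : e' ≤ e) :
      IsInductivelyFree A

/-- The cone `cA = {{z = 0}} ∪ {{α_H(x) + α_H(0)(z - 1) = 0} | H ∈ A}`, an arrangement in
`K^ι × K`, where `none` is the index of the additional coordinate `z`. -/
def cone {K : Type v} [Field K] {ι : Type u} (A : Set (Set (ι → K))) :
    Set (Set (Option ι → K)) :=
  {{y | y none = 0}} ∪
    {Y | ∃ H ∈ A, ∃ p : MvPolynomial ι K, IsDefiningPolynomial p H ∧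
      Y = {y | eval (fun i => y (some i)) p + eval 0 p * (y none - 1) = 0}}

open Classical in
/-- `ε_G(i,j)` is `1` if `(i,j)` is an edge of `G` and `0` otherwise. -/
noncomputable def edgeIndicator {V : Type u} (G : Digraph V) (i j : V) : ℤ :=
  if G.Adj i j then 1 else 0

/-- The arrangement `A(n,G)` of all hyperplanes `x_i - x_j = c` with `i ≠ j` and `c` an integer such
that `-n_i - ε_G(i,j) ≤ c ≤ n_j + ε_G(j,i)`. -/
def digraphArrangement (K : Type v) [Field K] {V : Type u} (n : V → ℕ) (G : Digraph V) :
    Set (Set (V → K)) :=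
  {H | ∃ (i j : V) (c : ℤ), i ≠ j ∧ -(n i : ℤ) - edgeIndicator G i j ≤ c ∧
    c ≤ (n j : ℤ) + edgeIndicator G j i ∧ H = {x | x i - x j = (c : K)}}

/-- The extended Catalan arrangement of type A: all hyperplanes `x_i - x_j = c` with `i ≠ j` and
`c` an integer such that `-m ≤ c ≤ m`. -/
def extendedCatalan (K : Type v) [Field K] (V : Type u) (m : ℕ) : Set (Set (V → K)) :=
  {H | ∃ (i j : V) (c : ℤ), i ≠ j ∧ -(m : ℤ) ≤ c ∧ c ≤ (m : ℤ) ∧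
    H = {x | x i - x j = (c : K)}}

end HyperplaneArrangement

/-! The engine is the addition theorem `IsFreeWithExponents.addition`. Write A' for A∖{H} and A''
for the restriction to H. For θ in D(A') look at the restriction of θ(α_H) to H; θ lies in D(A)
exactly when it vanishes. All these restrictions are divisible by one nonzero polynomial B on H of
degree |A'| - |A''| = d (`exists_dvd_pullback`). If exp(A') is exp(A'') with one extra d, a rank
count (`exists_degree_le_of_card_lt`) gives a basis element of degree at most d with nonzero
restriction, which must be a constant multiple of B. Subtracting multiples of this element moves the
other basis elements into D(A), and multiplying it by α_H does the same for it, so d becomes d + 1.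

For the arrangements themselves, allow weights n on a vertex set S and raise one weight n_k by one:
the hyperplanes x_i - x_k = (n_k+1)z are added one at a time, for i in S∖{k}. Restricting to such a
hyperplane merges i into k, and the result is again a weighted arrangement, with one vertex fewer
and weight n_i + n_k + 1 at k, whatever was added before (`image_preimage_weightedCone`). Its
exponents are thus the same at every step, and each addition raises the remaining exponent by one;
after |S| - 1 additions the consecutive block of exponents has shifted by one.

The induction runs on |S| and then on the total weight. Weight -1 on one vertex with 0 elsewhere
amounts to deleting that vertex, so even the all-zero (braid) case is reached by raising a weight.
-/

namespace HyperplaneArrangement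

universe u v w

/-! ### Linear forms as polynomials, hyperplanes and their parametrizations -/

section LinearForms

variable {K : Type v} [Field K] {ι : Type u} {κ : Type w} [Fintype ι] [Fintype κ]

open Classical in
/-- The linear form `f` as a polynomial. -/
noncomputable def linearPolynomial (f : (ι → K) →ₗ[K] K) : MvPolynomial ι K :=
  ∑ i, C (f (Pi.single i 1)) * X i

@[simp]
theorem eval_linearPolynomial (f : (ι → K) →ₗ[K] K) (x : ι → K) :
    eval x (linearPolynomial f) = f x := by
  classical
  simp only [linearPolynomial, map_sum, map_mul, eval_C, eval_X]
  conv_rhs => rw [LinearMap.pi_apply_eq_sum_univ f x]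
  refine Finset.sum_congr rfl fun i _ => ?_
  rw [smul_eq_mul, mul_comm]
  congr 2
  ext j
  simp [Pi.single_apply, eq_comm]

theorem isHomogeneous_linearPolynomial (f : (ι → K) →ₗ[K] K) :
    (linearPolynomial f).IsHomogeneous 1 :=
  IsHomogeneous.sum _ _ _ fun i _ => isHomogeneous_C_mul_X _ i

/-- Composition of polynomial functions with the linear map `φ`. -/
noncomputable def pullback {ι : Type u} (φ : (κ → K) →ₗ[K] (ι → K)) :
    MvPolynomial ι K →ₐ[K] MvPolynomial κ K :=
  aeval fun i => linearPolynomial (LinearMap.proj i ∘ₗ φ)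

@[simp]
theorem eval_pullback {ι : Type u} (φ : (κ → K) →ₗ[K] (ι → K)) (y : κ → K) (p : MvPolynomial ι K) :
    eval y (pullback φ p) = eval (φ y) p := by
  have h : ((aeval y : MvPolynomial κ K →ₐ[K] K).comp (pullback φ)) = aeval (φ y) := by
    ext i
    simp only [pullback, AlgHom.comp_apply, aeval_X]
    exact (RingHom.congr_fun (coe_aeval_eq_eval y) _).trans (by simp)
  simpa [AlgHom.comp_apply, coe_aeval_eq_eval] using congrArg (fun g => g p) h

theorem isHomogeneous_pullback {ι : Type u} (φ : (κ → K) →ₗ[K] (ι → K)) {p : MvPolynomial ι K} {m : ℕ}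
    (hp : p.IsHomogeneous m) : (pullback φ p).IsHomogeneous m := by
  simpa [pullback] using hp.aeval _ (fun i => isHomogeneous_linearPolynomial (K := K) _)


theorem linearPolynomial_eq_iff {f g : (ι → K) →ₗ[K] K} :
    linearPolynomial f = linearPolynomial g ↔ f = g := by
  refine ⟨fun h => LinearMap.ext fun x => ?_, fun h => h ▸ rfl⟩
  rw [← eval_linearPolynomial, h, eval_linearPolynomial]

@[simp]
theorem linearPolynomial_zero [CharZero K] : linearPolynomial (0 : (ι → K) →ₗ[K] K) = 0 :=
  MvPolynomial.funext fun x => by simp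

theorem linearPolynomial_add [CharZero K] (f g : (ι → K) →ₗ[K] K) :
    linearPolynomial (f + g) = linearPolynomial f + linearPolynomial g :=
  MvPolynomial.funext fun x => by simp

theorem linearPolynomial_smul [CharZero K] (c : K) (f : (ι → K) →ₗ[K] K) :
    linearPolynomial (c • f) = C c * linearPolynomial f :=
  MvPolynomial.funext fun x => by simp

theorem linearPolynomial_ne_zero [CharZero K] {f : (ι → K) →ₗ[K] K} (hf : f ≠ 0) : linearPolynomial f ≠ 0 := by
  rwa [Ne, ← linearPolynomial_zero, linearPolynomial_eq_iff]

theorem pullback_linearPolynomial [CharZero K] (φ : (κ → K) →ₗ[K] (ι → K)) (f : (ι → K) →ₗ[K] K) :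
    pullback φ (linearPolynomial f) = linearPolynomial (f ∘ₗ φ) :=
  MvPolynomial.funext fun x => by simp

theorem pullback_pullback_of_leftInverse [CharZero K] {φ : (κ → K) →ₗ[K] (ι → K)} {ψ : (ι → K) →ₗ[K] (κ → K)}
    (h : ψ ∘ₗ φ = LinearMap.id) (p : MvPolynomial κ K) : pullback φ (pullback ψ p) = p :=
  MvPolynomial.funext fun x => by
    have := congrArg (fun g => g x) h
    simp only [LinearMap.comp_apply, LinearMap.id_apply] at this
    simp [this]

/-- A linear form that vanishes on the kernel of a nonzero linear form `f` is a multiple of `f`. -/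
theorem exists_eq_smul_of_forall_eq_zero {E : Type*} [AddCommGroup E] [Module K E]
    {f g : E →ₗ[K] K} (hf : f ≠ 0) (h : ∀ x, f x = 0 → g x = 0) : ∃ c : K, g = c • f := by
  obtain ⟨w, hw⟩ : ∃ w, f w = 1 := by
    obtain ⟨w, hw⟩ := DFunLike.ne_iff.mp hf
    exact ⟨(f w)⁻¹ • w, by simpa using inv_mul_cancel₀ hw⟩
  refine ⟨g w, LinearMap.ext fun x => ?_⟩
  have := h (x - f x • w) (by simp [hw])
  simp only [map_sub, map_smul, smul_eq_mul, sub_eq_zero] at this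
  simp [this, mul_comm]

/-- The kernel of the pullback along a parametrization of the hyperplane `α = 0` is generated
by `α`. -/
theorem dvd_iff_pullback_eq_zero [CharZero K] {φ : (κ → K) →ₗ[K] (ι → K)} (hφ : Function.Injective φ)
    {α : (ι → K) →ₗ[K] K} (hα : α ≠ 0) (hr : Set.range φ = {x | α x = 0}) (p : MvPolynomial ι K) :
    linearPolynomial α ∣ p ↔ pullback φ p = 0 := by
  have hαφ : α ∘ₗ φ = 0 := LinearMap.ext fun y => by
    have : φ y ∈ {x | α x = 0} := hr ▸ Set.mem_range_self y
    simpa using this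
  constructor
  · rintro ⟨q, rfl⟩
    rw [map_mul, pullback_linearPolynomial, hαφ, linearPolynomial_zero, zero_mul]
  intro hp
  obtain ⟨ψ, hψ⟩ := LinearMap.exists_leftInverse_of_injective φ (LinearMap.ker_eq_bot.mpr hφ)
  -- The coordinate x_i minus its composite with the projection φψ vanishes on the hyperplane, hence
  -- is a multiple of α. So modulo α the quotient map factors through `pullback φ`, and the kernel
  -- of the latter lies in (α).
  have hX : ∀ i, linearPolynomial α ∣ X i - pullback ψ (pullback φ (X i)) := by
    intro i
    obtain ⟨c, hc⟩ := exists_eq_smul_of_forall_eq_zero hα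
      (g := LinearMap.proj i - LinearMap.proj i ∘ₗ φ ∘ₗ ψ) (fun x hx => by
        obtain ⟨y, rfl⟩ : x ∈ Set.range φ := hr ▸ hx
        have := congrArg (fun g => g y) hψ
        simp only [LinearMap.comp_apply, LinearMap.id_apply] at this
        simp [this])
    refine ⟨C c, MvPolynomial.funext fun x => ?_⟩
    have := congrArg (fun g => g x) hc
    simp only [LinearMap.sub_apply, LinearMap.proj_apply, LinearMap.comp_apply,
      LinearMap.smul_apply, smul_eq_mul] at this
    simp [this, mul_comm]
  have hmk : (Ideal.Quotient.mkₐ K (Ideal.span {linearPolynomial α})) =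
      (Ideal.Quotient.mkₐ K (Ideal.span {linearPolynomial α})).comp
        ((pullback ψ).comp (pullback φ)) := by
    ext i
    simp only [AlgHom.comp_apply, Ideal.Quotient.mkₐ_eq_mk]
    rw [Ideal.Quotient.mk_eq_mk_iff_sub_mem, Ideal.mem_span_singleton]
    exact hX i
  have := congrArg (fun g => g p) hmk
  simp only [AlgHom.comp_apply, Ideal.Quotient.mkₐ_eq_mk, hp, map_zero] at this
  rwa [Ideal.Quotient.eq_zero_iff_mem, Ideal.mem_span_singleton] at this

theorem exists_range_eq_setOf (f : (ι → K) →ₗ[K] K) :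
    ∃ (n : ℕ) (φ : (Fin n → K) →ₗ[K] (ι → K)), Function.Injective φ ∧
      Set.range φ = {x | f x = 0} := by
  let b := Module.finBasis K (LinearMap.ker f)
  refine ⟨_, (LinearMap.ker f).subtype ∘ₗ b.equivFun.symm.toLinearMap,
    Subtype.val_injective.comp b.equivFun.symm.injective, ?_⟩
  ext x
  constructor
  · rintro ⟨y, rfl⟩
    exact (b.equivFun.symm y).2
  · intro hx
    exact ⟨b.equivFun ⟨x, hx⟩, by simp⟩

/-- The ideal (f) is the kernel of the pullback to the coordinate ring of the hyperplane f = 0,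
which is a polynomial ring and so a domain. -/
theorem prime_linearPolynomial [CharZero K] {f : (ι → K) →ₗ[K] K} (hf : f ≠ 0) :
    Prime (linearPolynomial f) := by
  obtain ⟨n, φ, hφ, hr⟩ := exists_range_eq_setOf f
  rw [← Ideal.span_singleton_prime (linearPolynomial_ne_zero hf)]
  have : Ideal.span {linearPolynomial f} = RingHom.ker (pullback φ) := by
    ext p
    rw [Ideal.mem_span_singleton, dvd_iff_pullback_eq_zero hφ hf hr, RingHom.mem_ker]
  rw [this]
  exact RingHom.ker_isPrime _

theorem exists_eq_smul_of_dvd {f g : (ι → K) →ₗ[K] K} (hf : f ≠ 0)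
    (h : linearPolynomial f ∣ linearPolynomial g) : ∃ c : K, g = c • f := by
  refine exists_eq_smul_of_forall_eq_zero hf fun x hx => ?_
  obtain ⟨q, hq⟩ := h
  rw [← eval_linearPolynomial, hq, map_mul, eval_linearPolynomial, hx, zero_mul]

theorem setOf_smul_eq_zero {ι : Type u} {c : K} (hc : c ≠ 0) (f : (ι → K) →ₗ[K] K) :
    {x | (c • f) x = 0} = {x | f x = 0} := by
  ext x
  simp [hc]

theorem isRelPrime_linearPolynomial [CharZero K] {f g : (ι → K) →ₗ[K] K} (hf : f ≠ 0) (hg : g ≠ 0)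
    (h : {x | f x = 0} ≠ {x | g x = 0}) :
    IsRelPrime (linearPolynomial f) (linearPolynomial g) := by
  rw [(prime_linearPolynomial hf).irreducible.isRelPrime_iff_not_dvd]
  intro hd
  obtain ⟨c, rfl⟩ := exists_eq_smul_of_dvd hf hd
  refine h (setOf_smul_eq_zero ?_ f).symm
  rintro rfl
  simp at hg

theorem totalDegree_linearPolynomial_sub_C [CharZero K] {f : (ι → K) →ₗ[K] K} (hf : f ≠ 0) (c : K) :
    (linearPolynomial f - C c).totalDegree = 1 := by
  have h1 := (isHomogeneous_linearPolynomial f).totalDegree (linearPolynomial_ne_zero hf)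
  rw [sub_eq_add_neg, ← C_neg, totalDegree_add_eq_left_of_totalDegree_lt, h1]
  rw [h1, totalDegree_C]
  exact one_pos

theorem exists_eq_linearPolynomial_of_isHomogeneous_one [CharZero K] {p : MvPolynomial ι K}
    (hp : p.IsHomogeneous 1) : ∃ f : (ι → K) →ₗ[K] K, p = linearPolynomial f := by
  have hp' : p ∈ homogeneousSubmodule ι K 1 := hp
  rw [homogeneousSubmodule_one_eq_span_X] at hp'
  induction hp' using Submodule.span_induction with
  | mem x hx =>
    obtain ⟨i, rfl⟩ := hx
    exact ⟨LinearMap.proj i, MvPolynomial.funext fun x => by simp⟩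
  | zero => exact ⟨0, linearPolynomial_zero.symm⟩
  | add x y hx hy hx' hy' =>
    rw [← homogeneousSubmodule_one_eq_span_X] at hx hy
    obtain ⟨f, rfl⟩ := hx' hx
    obtain ⟨g, rfl⟩ := hy' hy
    exact ⟨f + g, (linearPolynomial_add f g).symm⟩
  | smul a x hx hx' =>
    rw [← homogeneousSubmodule_one_eq_span_X] at hx
    obtain ⟨f, rfl⟩ := hx' hx
    exact ⟨a • f, by rw [linearPolynomial_smul, smul_eq_C_mul]⟩

/-- A polynomial of degree one is the difference of a nonzero linear form and a constant. -/
theorem exists_eq_linearPolynomial_sub_C [CharZero K] {p : MvPolynomial ι K}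
    (hp : p.totalDegree = 1) : ∃ (f : (ι → K) →ₗ[K] K) (c : K), f ≠ 0 ∧
      p = linearPolynomial f - C c := by
  obtain ⟨f, hf⟩ := exists_eq_linearPolynomial_of_isHomogeneous_one
    (homogeneousComponent_isHomogeneous 1 p)
  have h : p = linearPolynomial f - C (-coeff 0 p) := by
    conv_lhs => rw [← sum_homogeneousComponent p, hp]
    rw [Finset.sum_range_succ, Finset.sum_range_one, hf, homogeneousComponent_zero, C_neg]
    ring
  refine ⟨f, _, ?_, h⟩
  rintro rfl
  rw [h, linearPolynomial_zero, zero_sub, ← C_neg, totalDegree_C] at hp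
  exact zero_ne_one hp

/-- A degree-one polynomial is g - d; equality of zero sets makes g vanish on the directions of f =
c, so g is proportional to f, and one point of the hyperplane fixes d. -/
theorem isDefiningPolynomial_iff [CharZero K] {f : (ι → K) →ₗ[K] K} (hf : f ≠ 0) (c : K)
    (p : MvPolynomial ι K) :
    IsDefiningPolynomial p {x | f x = c} ↔ ∃ u : K, u ≠ 0 ∧ p = C u * (linearPolynomial f - C c) := by
  constructor
  · rintro ⟨hp, hpH⟩
    obtain ⟨g, d, hg, rfl⟩ := exists_eq_linearPolynomial_sub_C hp
    have key : ∀ x, f x = c ↔ g x = d := fun x => by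
      have := congrArg (fun s => x ∈ s) hpH
      simpa [sub_eq_zero] using this
    obtain ⟨x₀, hx₀⟩ := LinearMap.surjective hf c
    obtain ⟨u, rfl⟩ := exists_eq_smul_of_forall_eq_zero (g := g) hf fun h hh => by
      have h1 := (key x₀).mp hx₀
      have h2 := (key (x₀ + h)).mp (by rw [map_add, hx₀, hh, add_zero])
      rwa [map_add, h1, add_eq_left] at h2
    have hu : u ≠ 0 := by
      rintro rfl
      simp at hg
    refine ⟨u, hu, ?_⟩
    have := (key x₀).mp hx₀
    rw [linearPolynomial_smul, ← this, LinearMap.smul_apply, hx₀, smul_eq_mul, C_mul, mul_sub]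
  · rintro ⟨u, hu, rfl⟩
    have h : C u * (linearPolynomial f - C c) = linearPolynomial (u • f) - C (u * c) := by
      rw [linearPolynomial_smul, C_mul, mul_sub]
    constructor
    · rw [h]
      exact totalDegree_linearPolynomial_sub_C (smul_ne_zero hu hf) _
    · ext x
      simp [hu, sub_eq_zero]

theorem isDefiningPolynomial_central_iff [CharZero K] {f : (ι → K) →ₗ[K] K} (hf : f ≠ 0)
    (p : MvPolynomial ι K) :
    IsDefiningPolynomial p {x | f x = 0} ↔ ∃ u : K, u ≠ 0 ∧ p = C u * linearPolynomial f := by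
  rw [isDefiningPolynomial_iff hf, C_0, sub_zero]

theorem IsCentralArrangement.exists_form [CharZero K] {A : Set (Set (ι → K))}
    (hA : IsCentralArrangement A) {H : Set (ι → K)} (hH : H ∈ A) :
    ∃ f : (ι → K) →ₗ[K] K, f ≠ 0 ∧ H = {x | f x = 0} := by
  obtain ⟨p, hp, hpH⟩ := hA.isHyperplane H hH
  obtain ⟨f, c, hf, rfl⟩ := exists_eq_linearPolynomial_sub_C hp
  have h0 := hA.zero_mem H hH
  rw [hpH] at h0
  have hc : c = 0 := by simpa using h0
  refine ⟨f, hf, ?_⟩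
  rw [hpH, hc]
  simp

theorem isCentralArrangement_of_forms [CharZero K] {A : Set (Set (ι → K))} (hfin : A.Finite)
    (hA : ∀ H ∈ A, ∃ f : (ι → K) →ₗ[K] K, f ≠ 0 ∧ H = {x | f x = 0}) :
    IsCentralArrangement A where
  finite := hfin
  isHyperplane := fun H hH => by
    obtain ⟨f, hf, rfl⟩ := hA H hH
    exact ⟨linearPolynomial f,
      (isDefiningPolynomial_central_iff hf _).mpr ⟨1, one_ne_zero, by simp⟩⟩
  zero_mem := fun H hH => by
    obtain ⟨f, hf, rfl⟩ := hA H hH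
    simp

theorem derivation_apply_C_mul {ι : Type u}
    (θ : Derivation K (MvPolynomial ι K) (MvPolynomial ι K)) (c : K) (p : MvPolynomial ι K) :
    θ (C c * p) = C c * θ p := by
  rw [← smul_eq_C_mul, θ.map_smul, smul_eq_C_mul]

theorem mem_logDerivations_iff [CharZero K] {A : Set (Set (ι → K))}
    (hA : IsCentralArrangement A)
    {θ : Derivation K (MvPolynomial ι K) (MvPolynomial ι K)} :
    θ ∈ logDerivations A ↔ ∀ f : (ι → K) →ₗ[K] K, f ≠ 0 → {x | f x = 0} ∈ A →
      linearPolynomial f ∣ θ (linearPolynomial f) := by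
  constructor
  · intro h f hf hfA
    exact h _ hfA _ ((isDefiningPolynomial_central_iff hf _).mpr ⟨1, one_ne_zero, by simp⟩)
  · intro h H hH p hp
    obtain ⟨f, hf, rfl⟩ := hA.exists_form hH
    obtain ⟨u, hu, rfl⟩ := (isDefiningPolynomial_central_iff hf p).mp hp
    rw [derivation_apply_C_mul]
    exact mul_dvd_mul_left _ (h f hf hH)

end LinearForms

/-! ### Homogeneous components of products -/

section Homogeneous

variable {K : Type v} [Field K] {ι : Type u}

theorem homogeneousComponent_mul_of_isHomogeneous {p q : MvPolynomial ι K} {d : ℕ}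
    (hq : q.IsHomogeneous d) (m : ℕ) :
    homogeneousComponent m (p * q) =
      if d ≤ m then homogeneousComponent (m - d) p * q else 0 := by
  have h : ∀ k, homogeneousComponent m (homogeneousComponent k p * q) =
      if m = k + d then homogeneousComponent k p * q else 0 := fun k => by
    have hk : homogeneousComponent k p * q ∈ homogeneousSubmodule ι K (k + d) :=
      (homogeneousComponent_isHomogeneous k p).mul hq
    rw [homogeneousComponent_of_mem hk]
  conv_lhs => rw [← sum_homogeneousComponent p, Finset.sum_mul, map_sum]
  simp only [h]
  split_ifs with hdm
  · have h' : ∀ k, m = k + d ↔ k = m - d := fun k => by omega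
    simp only [h']
    rw [Finset.sum_ite_eq']
    split_ifs with hk
    · rfl
    · rw [homogeneousComponent_eq_zero, zero_mul]
      rw [Finset.mem_range] at hk
      omega
  · exact Finset.sum_eq_zero fun k _ => if_neg (by omega)

theorem isHomogeneousDerivation_apply_linearPolynomial [Fintype ι]
    {θ : Derivation K (MvPolynomial ι K) (MvPolynomial ι K)} {d : ℕ}
    (hθ : IsHomogeneousDerivation θ d) (f : (ι → K) →ₗ[K] K) :
    (θ (linearPolynomial f)).IsHomogeneous d := by
  simp only [linearPolynomial, map_sum, derivation_apply_C_mul]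
  exact IsHomogeneous.sum _ _ _ fun i _ => (hθ i).C_mul _

end Homogeneous

/-! ### Proportional forms and scalar factors -/

section Auxiliary

variable {K : Type v} [Field K] {ι : Type u} {κ : Type w}

theorem comp_ne_zero_of_ne {f g : (ι → K) →ₗ[K] K} (hf : f ≠ 0) (hg : g ≠ 0)
    (h : {x | g x = 0} ≠ {x | f x = 0}) {φ : (κ → K) →ₗ[K] (ι → K)}
    (hr : Set.range φ = {x | f x = 0}) : g ∘ₗ φ ≠ 0 := by
  intro h0
  obtain ⟨c, rfl⟩ := exists_eq_smul_of_forall_eq_zero (g := g) hf fun x hx => by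
    obtain ⟨y, rfl⟩ : x ∈ Set.range φ := hr ▸ hx
    exact congrArg (fun l => l y) h0
  refine h (setOf_smul_eq_zero ?_ f)
  rintro rfl
  simp at hg

theorem IsCentralArrangement.mono {A B : Set (Set (ι → K))} (hA : IsCentralArrangement A)
    (h : B ⊆ A) : IsCentralArrangement B :=
  ⟨⟨hA.finite.subset h, fun H hH => hA.isHyperplane H (h hH)⟩, fun H hH => hA.zero_mem H (h hH)⟩

theorem exists_eq_smul_of_setOf_eq {f g : (ι → K) →ₗ[K] K} (hf : f ≠ 0) (hg : g ≠ 0)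
    (h : {x | f x = 0} = {x | g x = 0}) : ∃ c : K, c ≠ 0 ∧ g = c • f := by
  obtain ⟨c, rfl⟩ := exists_eq_smul_of_forall_eq_zero (g := g) hf fun x hx =>
    (congrArg (fun s => x ∈ s) h).mp hx
  refine ⟨c, ?_, rfl⟩
  rintro rfl
  simp at hg

theorem C_mul_dvd_C_mul_iff {c : K} (hc : c ≠ 0) {p q : MvPolynomial ι K} :
    C c * p ∣ C c * q ↔ p ∣ q :=
  mul_dvd_mul_iff_left (by simpa using hc)

theorem dvd_C_mul_iff {c : K} (hc : c ≠ 0) {p q : MvPolynomial ι K} :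
    p ∣ C c * q ↔ p ∣ q :=
  (isUnit_iff_ne_zero.mpr hc |>.map C).dvd_mul_left

end Auxiliary

/-! ### Restriction to a hyperplane: the polynomial B and induced derivations -/

section Restriction

variable {K : Type v} [Field K] [CharZero K] {ι : Type u} {κ : Type w} [Fintype ι] [Fintype κ]

/-- The restriction of a central arrangement to `H`, in coordinates. -/
theorem image_restriction_eq {κ : Type w} {A : Set (Set (ι → K))} (hA : IsCentralArrangement A)
    {H : Set (ι → K)} (hH : H ∈ A) {φ : (κ → K) →ₗ[K] (ι → K)} (hr : Set.range φ = H) :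
    (fun Y : Set (ι → K) => φ ⁻¹' Y) '' restriction A H =
      (fun Y : Set (ι → K) => φ ⁻¹' Y) '' (A \ {H}) := by
  have hpre : ∀ Y : Set (ι → K), φ ⁻¹' (Y ∩ H) = φ ⁻¹' Y := fun Y => by
    rw [← hr, Set.preimage_inter_range]
  ext X
  constructor
  · rintro ⟨_, ⟨H', hH', hsub, -, rfl⟩, rfl⟩
    refine ⟨H', ⟨hH', ?_⟩, (hpre H').symm⟩
    rintro rfl
    exact hsub subset_rfl
  · rintro ⟨H', ⟨hH', hne⟩, rfl⟩
    refine ⟨H' ∩ H, ⟨H', hH', fun hsub => hne ?_, ⟨0, hA.zero_mem _ hH', hA.zero_mem _ hH⟩, rfl⟩,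
      hpre H'⟩
    obtain ⟨f, hf, rfl⟩ := hA.exists_form hH
    obtain ⟨g, hg, rfl⟩ := hA.exists_form hH'
    obtain ⟨c, rfl⟩ := exists_eq_smul_of_forall_eq_zero hf fun x hx => hsub hx
    refine setOf_smul_eq_zero ?_ f
    rintro rfl
    simp at hg

theorem isCentralArrangement_image_preimage {A : Set (Set (ι → K))} (hA : IsCentralArrangement A)
    {α : (ι → K) →ₗ[K] K} (hα : α ≠ 0) {φ : (κ → K) →ₗ[K] (ι → K)}
    (hr : Set.range φ = {x | α x = 0}) :
    IsCentralArrangement ((fun Y : Set (ι → K) => φ ⁻¹' Y) '' (A \ {{x | α x = 0}})) := by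
  refine isCentralArrangement_of_forms ((hA.finite.subset Set.sdiff_subset).image _) ?_
  rintro _ ⟨H, ⟨hH, hne⟩, rfl⟩
  obtain ⟨f, hf, rfl⟩ := hA.exists_form hH
  exact ⟨f ∘ₗ φ, comp_ne_zero_of_ne hα hf hne hr, rfl⟩

/-- For `θ ∈ D(A \ {H})`, the restriction of `θ(α_H)` to `H` is divisible by `β^(k-1)`, where `k`
hyperplanes of `A \ {H}` meet `H` in the zero set of `β`. -/
theorem pow_dvd_mul_pullback {A : Set (Set (ι → K))} (hA : IsCentralArrangement A)
    {α : (ι → K) →ₗ[K] K} (hα : α ≠ 0) {φ : (κ → K) →ₗ[K] (ι → K)} (hφ : Function.Injective φ)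
    (hr : Set.range φ = {x | α x = 0})
    {θ : Derivation K (MvPolynomial ι K) (MvPolynomial ι K)}
    (hθ : θ ∈ logDerivations (A \ {{x | α x = 0}}))
    {β : (κ → K) →ₗ[K] K} (hβ : β ≠ 0) (F : Finset (Set (ι → K)))
    (hF : ∀ H ∈ F, H ∈ A \ {{x | α x = 0}} ∧ φ ⁻¹' H = {y | β y = 0}) :
    linearPolynomial β ^ F.card ∣ linearPolynomial β * pullback φ (θ (linearPolynomial α)) := by
  have hform : ∀ H ∈ F, ∃ f : (ι → K) →ₗ[K] K, f ≠ 0 ∧ H = {x | f x = 0} := fun H hH =>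
    hA.exists_form (hF H hH).1.1
  choose! g hg0 hgH using hform
  obtain ⟨ψ, hψ⟩ := LinearMap.exists_leftInverse_of_injective φ (LinearMap.ker_eq_bot.mpr hφ)
  have hψ' : ∀ y, ψ (φ y) = y := fun y => congrArg (fun l => l y) hψ
  have hαφ : pullback φ (linearPolynomial α) = 0 :=
    (dvd_iff_pullback_eq_zero hφ hα hr _).mp dvd_rfl
  have hcomp : ∀ H ∈ F, ∃ u : K, u ≠ 0 ∧ g H ∘ₗ φ = u • β := fun H hH => by
    refine exists_eq_smul_of_setOf_eq hβ (comp_ne_zero_of_ne hα (hg0 H hH) ?_ hr) ?_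
    · rw [← hgH H hH]
      exact (hF H hH).1.2
    · rw [← (hF H hH).2]
      conv_lhs => rw [hgH H hH]
      rfl
  -- With β̃ = β∘ψ, each form g_H equals uβ̃ + aα with u ≠ 0, so uD = αθ(g_H) - g_H θ(α) is
  -- divisible by g_H. The g_H are pairwise coprime, so their product divides D; on H the term with
  -- α dies and each g_H becomes a multiple of β.
  set D : MvPolynomial ι K := linearPolynomial α * θ (linearPolynomial (β ∘ₗ ψ)) -
    linearPolynomial (β ∘ₗ ψ) * θ (linearPolynomial α) with hD
  have hdvd : ∀ H ∈ F, linearPolynomial (g H) ∣ D := fun H hH => by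
    obtain ⟨u, hu, hgu⟩ := hcomp H hH
    obtain ⟨a, ha⟩ := exists_eq_smul_of_forall_eq_zero (g := g H - u • (β ∘ₗ ψ)) hα fun x hx => by
      obtain ⟨y, rfl⟩ : x ∈ Set.range φ := hr ▸ hx
      have : g H (φ y) = u • β y := congrArg (fun l => l y) hgu
      simp [this, hψ']
    have hgH' : linearPolynomial (g H) =
        C u * linearPolynomial (β ∘ₗ ψ) + C a * linearPolynomial α := by
      rw [← linearPolynomial_smul, ← linearPolynomial_smul, ← linearPolynomial_add, ← ha]
      congr 1
      abel
    have hθg : linearPolynomial (g H) ∣ θ (linearPolynomial (g H)) := by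
      refine (mem_logDerivations_iff (hA.mono Set.sdiff_subset)).mp hθ _ (hg0 H hH) ?_
      rw [← hgH H hH]
      exact (hF H hH).1
    rw [← dvd_C_mul_iff hu]
    have : C u * D = linearPolynomial α * θ (linearPolynomial (g H)) -
        linearPolynomial (g H) * θ (linearPolynomial α) := by
      rw [hgH', map_add, derivation_apply_C_mul, derivation_apply_C_mul, hD]
      ring
    rw [this]
    exact dvd_sub (hθg.mul_left _) (dvd_mul_right _ _)
  have hprod : (∏ H ∈ F, linearPolynomial (g H)) ∣ D := by
    refine Finset.prod_dvd_of_isRelPrime (fun H hH H' hH' hne => ?_) hdvd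
    refine isRelPrime_linearPolynomial (hg0 H hH) (hg0 H' hH') ?_
    rwa [← hgH H hH, ← hgH H' hH']
  have h1 := map_dvd (pullback φ) hprod
  rw [map_prod, hD, map_sub, map_mul, hαφ, zero_mul, zero_sub, dvd_neg, map_mul,
    pullback_linearPolynomial, LinearMap.comp_assoc, hψ, LinearMap.comp_id] at h1
  refine dvd_trans ?_ h1
  rw [← Finset.prod_const]
  refine Finset.prod_dvd_prod_of_dvd _ _ fun H hH => ?_
  obtain ⟨u, -, hgu⟩ := hcomp H hH
  rw [pullback_linearPolynomial, hgu, linearPolynomial_smul]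
  exact dvd_mul_left _ _

/-- B is the product over the hyperplanes X of the restriction of β_X^(k_X - 1), where k_X
hyperplanes of A∖{H} have trace X on H. Since the k_X sum to |A∖{H}|, its degree is |A∖{H}| minus
the number of traces. -/
theorem exists_dvd_pullback {A : Set (Set (ι → K))} (hA : IsCentralArrangement A)
    {α : (ι → K) →ₗ[K] K} (hα : α ≠ 0) {φ : (κ → K) →ₗ[K] (ι → K)} (hφ : Function.Injective φ)
    (hr : Set.range φ = {x | α x = 0}) {d : ℕ}
    (hcard : (A \ {{x | α x = 0}}).ncard =
      ((fun Y : Set (ι → K) => φ ⁻¹' Y) '' (A \ {{x | α x = 0}})).ncard + d) :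
    ∃ B : MvPolynomial κ K, B ≠ 0 ∧ B.IsHomogeneous d ∧
      ∀ θ ∈ logDerivations (A \ {{x | α x = 0}}), B ∣ pullback φ (θ (linearPolynomial α)) := by
  classical
  have hA'' := isCentralArrangement_image_preimage hA hα hr
  set A' := A \ {{x | α x = 0}} with hA'
  have hfin : A'.Finite := hA.finite.subset Set.sdiff_subset
  set r : Set (ι → K) → Set (κ → K) := fun Y => φ ⁻¹' Y with hrdef
  have hform : ∀ X ∈ r '' A', ∃ f : (κ → K) →ₗ[K] K, f ≠ 0 ∧ X = {x | f x = 0} := fun X hX =>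
    hA''.exists_form hX
  choose! β hβ0 hβX using hform
  set s := hfin.toFinset with hs
  set F : Set (κ → K) → Finset (Set (ι → K)) := fun X => s.filter fun H => r H = X with hFdef
  have hmem : ∀ X ∈ s.image r, X ∈ r '' A' := fun X hX => by
    simpa [hs] using hX
  have hFpos : ∀ X ∈ s.image r, 1 ≤ (F X).card := fun X hX => by
    obtain ⟨H, hH, rfl⟩ := Finset.mem_image.mp hX
    exact Finset.card_pos.mpr ⟨H, Finset.mem_filter.mpr ⟨hH, rfl⟩⟩
  refine ⟨∏ X ∈ s.image r, linearPolynomial (β X) ^ ((F X).card - 1), ?_, ?_, fun θ hθ => ?_⟩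
  · exact Finset.prod_ne_zero_iff.mpr fun X hX =>
      pow_ne_zero _ (linearPolynomial_ne_zero (hβ0 X (hmem X hX)))
  · have hd : ∑ X ∈ s.image r, 1 * ((F X).card - 1) = d := by
      have h1 : s.card = ∑ X ∈ s.image r, (F X).card := Finset.card_eq_sum_card_image r s
      have h2 : ∑ X ∈ s.image r, (F X).card =
          ∑ X ∈ s.image r, 1 * ((F X).card - 1) + (s.image r).card := by
        rw [Finset.card_eq_sum_ones, ← Finset.sum_add_distrib]
        exact Finset.sum_congr rfl fun X hX => by have := hFpos X hX; omega
      have h3 : A'.ncard = s.card := Set.ncard_eq_toFinset_card A' hfin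
      have h4 : (r '' A').ncard = (s.image r).card := by
        rw [← Set.ncard_coe_finset, Finset.coe_image, hs, hfin.coe_toFinset]
      omega
    rw [← hd]
    exact IsHomogeneous.prod _ _ _ fun X _ => (isHomogeneous_linearPolynomial _).pow _
  · refine Finset.prod_dvd_of_isRelPrime (fun X hX Y hY hne => ?_) fun X hX => ?_
    · refine IsRelPrime.pow (isRelPrime_linearPolynomial (hβ0 X (hmem X hX)) (hβ0 Y (hmem Y hY)) ?_)
      rwa [← hβX X (hmem X hX), ← hβX Y (hmem Y hY)]
    · have h := pow_dvd_mul_pullback hA hα hφ hr hθ (hβ0 X (hmem X hX)) (F X) fun H hH => by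
        rw [hFdef, Finset.mem_filter, hs, hfin.mem_toFinset] at hH
        exact ⟨hH.1, hH.2.trans (hβX X (hmem X hX))⟩
      obtain ⟨k, hk⟩ : ∃ k, (F X).card = k + 1 := ⟨(F X).card - 1, by have := hFpos X hX; omega⟩
      rw [hk] at h ⊢
      rw [pow_succ', mul_dvd_mul_iff_left (linearPolynomial_ne_zero (hβ0 X (hmem X hX)))] at h
      exact h

/-- The derivation of the coordinate ring of a hyperplane that is induced by `θ`; here `φ`
parametrizes the hyperplane and `ψ` is a left inverse of `φ`. -/
noncomputable def restrictDerivation (φ : (κ → K) →ₗ[K] (ι → K)) (ψ : (ι → K) →ₗ[K] (κ → K))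
    (h : ψ ∘ₗ φ = LinearMap.id) (θ : Derivation K (MvPolynomial ι K) (MvPolynomial ι K)) :
    Derivation K (MvPolynomial κ K) (MvPolynomial κ K) :=
  Derivation.mk' ((pullback φ).toLinearMap ∘ₗ (θ : MvPolynomial ι K →ₗ[K] MvPolynomial ι K) ∘ₗ
    (pullback ψ).toLinearMap) fun a b => by
      simp [pullback_pullback_of_leftInverse h]

theorem restrictDerivation_apply {φ : (κ → K) →ₗ[K] (ι → K)} {ψ : (ι → K) →ₗ[K] (κ → K)}
    (h : ψ ∘ₗ φ = LinearMap.id) (θ : Derivation K (MvPolynomial ι K) (MvPolynomial ι K))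
    (q : MvPolynomial κ K) :
    restrictDerivation φ ψ h θ q = pullback φ (θ (pullback ψ q)) := rfl

/-- The difference of p and ψ*φ*p is αq for some q, and θ(αq) = αθ(q) + qθ(α) vanishes on H. Hence
the induced derivation does not depend on the chosen left inverse ψ. -/
theorem restrictDerivation_pullback {α : (ι → K) →ₗ[K] K} (hα : α ≠ 0)
    {φ : (κ → K) →ₗ[K] (ι → K)} (hφ : Function.Injective φ) (hr : Set.range φ = {x | α x = 0})
    {ψ : (ι → K) →ₗ[K] (κ → K)} (h : ψ ∘ₗ φ = LinearMap.id)
    {θ : Derivation K (MvPolynomial ι K) (MvPolynomial ι K)}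
    (hθ : pullback φ (θ (linearPolynomial α)) = 0) (p : MvPolynomial ι K) :
    restrictDerivation φ ψ h θ (pullback φ p) = pullback φ (θ p) := by
  have h0 : pullback φ (p - pullback ψ (pullback φ p)) = 0 := by
    rw [map_sub, pullback_pullback_of_leftInverse h, sub_self]
  obtain ⟨q, hq⟩ := (dvd_iff_pullback_eq_zero hφ hα hr _).mpr h0
  have hαφ : pullback φ (linearPolynomial α) = 0 :=
    (dvd_iff_pullback_eq_zero hφ hα hr _).mp dvd_rfl
  have h1 := congrArg (fun x => pullback φ (θ x)) hq
  simp only [map_sub, Derivation.leibniz, smul_eq_mul, map_add, map_mul, hαφ, hθ, zero_mul,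
    mul_zero, add_zero, sub_eq_zero] at h1
  rw [restrictDerivation_apply, h1]

theorem mem_logDerivations_iff_pullback {A : Set (Set (ι → K))} (hA : IsCentralArrangement A)
    {α : (ι → K) →ₗ[K] K} (hα : α ≠ 0) (hαA : {x | α x = 0} ∈ A)
    {φ : (κ → K) →ₗ[K] (ι → K)} (hφ : Function.Injective φ)
    (hr : Set.range φ = {x | α x = 0})
    {θ : Derivation K (MvPolynomial ι K) (MvPolynomial ι K)}
    (hθ : θ ∈ logDerivations (A \ {{x | α x = 0}})) :
    θ ∈ logDerivations A ↔ pullback φ (θ (linearPolynomial α)) = 0 := by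
  rw [← dvd_iff_pullback_eq_zero hφ hα hr]
  constructor
  · intro h
    exact (mem_logDerivations_iff hA).mp h α hα hαA
  · intro h H hH p hp
    by_cases hHα : H = {x | α x = 0}
    · subst hHα
      obtain ⟨u, hu, rfl⟩ := (isDefiningPolynomial_central_iff hα p).mp hp
      rw [derivation_apply_C_mul]
      exact mul_dvd_mul_left _ h
    · exact hθ H ⟨hH, hHα⟩ p hp

theorem restrictDerivation_mem {A : Set (Set (ι → K))} (hA : IsCentralArrangement A)
    {α : (ι → K) →ₗ[K] K} (hα : α ≠ 0) (hαA : {x | α x = 0} ∈ A)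
    {φ : (κ → K) →ₗ[K] (ι → K)} (hφ : Function.Injective φ)
    (hr : Set.range φ = {x | α x = 0}) {ψ : (ι → K) →ₗ[K] (κ → K)} (h : ψ ∘ₗ φ = LinearMap.id)
    {θ : Derivation K (MvPolynomial ι K) (MvPolynomial ι K)} (hθ : θ ∈ logDerivations A) :
    restrictDerivation φ ψ h θ ∈
      logDerivations ((fun Y : Set (ι → K) => φ ⁻¹' Y) '' (A \ {{x | α x = 0}})) := by
  have hθα : pullback φ (θ (linearPolynomial α)) = 0 :=
    (dvd_iff_pullback_eq_zero hφ hα hr _).mp ((mem_logDerivations_iff hA).mp hθ α hα hαA)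
  rw [mem_logDerivations_iff (isCentralArrangement_image_preimage hA hα hr)]
  rintro f hf ⟨H, ⟨hH, hne⟩, hHf⟩
  obtain ⟨g, hg, rfl⟩ := hA.exists_form hH
  obtain ⟨u, hu, hgu⟩ := exists_eq_smul_of_setOf_eq hf (comp_ne_zero_of_ne hα hg hne hr) hHf.symm
  have h1 := map_dvd (pullback φ) ((mem_logDerivations_iff hA).mp hθ g hg hH)
  rwa [← restrictDerivation_pullback hα hφ hr h hθα, pullback_linearPolynomial, hgu,
    linearPolynomial_smul, derivation_apply_C_mul, C_mul_dvd_C_mul_iff hu] at h1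

theorem isHomogeneousDerivation_restrictDerivation {φ : (κ → K) →ₗ[K] (ι → K)}
    {ψ : (ι → K) →ₗ[K] (κ → K)} (h : ψ ∘ₗ φ = LinearMap.id)
    {θ : Derivation K (MvPolynomial ι K) (MvPolynomial ι K)} {d : ℕ}
    (hθ : IsHomogeneousDerivation θ d) :
    IsHomogeneousDerivation (restrictDerivation φ ψ h θ) d := fun j => by
  have : (X j : MvPolynomial κ K) = linearPolynomial (LinearMap.proj j) :=
    MvPolynomial.funext fun x => by simp
  rw [restrictDerivation_apply, this, pullback_linearPolynomial]
  exact isHomogeneous_pullback _ (isHomogeneousDerivation_apply_linearPolynomial hθ _)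

/-- A derivation in `D(A \ {H})` that restricts to zero on `H` is a multiple of `α_H`. -/
theorem exists_eq_smul_of_restrictDerivation_eq_zero {A : Set (Set (ι → K))}
    (hA : IsCentralArrangement A)
    {α : (ι → K) →ₗ[K] K} (hα : α ≠ 0) {φ : (κ → K) →ₗ[K] (ι → K)} (hφ : Function.Injective φ)
    (hr : Set.range φ = {x | α x = 0}) {ψ : (ι → K) →ₗ[K] (κ → K)} (h : ψ ∘ₗ φ = LinearMap.id)
    {θ : Derivation K (MvPolynomial ι K) (MvPolynomial ι K)}
    (hθ : θ ∈ logDerivations (A \ {{x | α x = 0}}))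
    (hθα : pullback φ (θ (linearPolynomial α)) = 0) (h0 : restrictDerivation φ ψ h θ = 0) :
    ∃ η ∈ logDerivations (A \ {{x | α x = 0}}), θ = linearPolynomial α • η := by
  have hd : ∀ i, linearPolynomial α ∣ θ (X i) := fun i => by
    rw [dvd_iff_pullback_eq_zero hφ hα hr, ← restrictDerivation_pullback hα hφ hr h hθα, h0]
    rfl
  choose q hq using hd
  have hη : θ = linearPolynomial α • mkDerivation K q := by
    refine derivation_ext fun i => ?_
    rw [hq, Derivation.smul_apply, mkDerivation_X, smul_eq_mul]
  refine ⟨mkDerivation K q, ?_, hη⟩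
  have hA' := hA.mono (Set.sdiff_subset (t := {{x | α x = 0}}))
  rw [mem_logDerivations_iff hA'] at hθ ⊢
  intro f hf hfA
  have h1 := hθ f hf hfA
  rw [hη, Derivation.smul_apply, smul_eq_mul] at h1
  exact (isRelPrime_linearPolynomial hf hα hfA.2).dvd_of_dvd_mul_left h1

end Restriction

/-! ### Change of basis under a divisibility condition -/

section Basis

open Classical in
/-- A basis of the submodule cut out by a divisibility condition on the coordinates. -/
theorem exists_basis_of_dvd {R M ι : Type*} [CommRing R] [IsDomain R] [AddCommGroup M] [Module R M]
    [Fintype ι] {N N' : Submodule R M} (hle : N ≤ N') (b : Module.Basis ι R N') (i₀ : ι) {a : R}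
    (ha : a ≠ 0) {g : ι → R} (hg : g i₀ = 0) (hmem₀ : a • (b i₀ : M) ∈ N)
    (hmem : ∀ i, i ≠ i₀ → (b i : M) - g i • (b i₀ : M) ∈ N)
    (hdvd : ∀ x : N', (x : M) ∈ N → a ∣ b.repr x i₀ + ∑ j, b.repr x j * g j) :
    ∃ b' : Module.Basis ι R N, ∀ i,
      (b' i : M) = if i = i₀ then a • (b i₀ : M) else (b i : M) - g i • (b i₀ : M) := by
  set v : ι → N := fun i => ⟨if i = i₀ then a • (b i₀ : M) else (b i : M) - g i • (b i₀ : M), by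
    split_ifs with hi
    exacts [hmem₀, hmem i hi]⟩ with hv
  -- One formula covers both cases because g vanishes at i₀.
  have hvb : ∀ i, Submodule.inclusion hle (v i) = (if i = i₀ then a else 1) • b i - g i • b i₀ :=
    fun i => Subtype.ext <| by
      by_cases hi : i = i₀
      · simp [hv, hi, hg]
      · simp [hv, hi]
  have hsum : ∀ c : ι → R, Submodule.inclusion hle (∑ i, c i • v i) =
      ∑ i, (c i * (if i = i₀ then a else 1) - if i = i₀ then ∑ j, c j * g j else 0) • b i := by
    intro c
    simp only [map_sum, map_smul, hvb, smul_sub, sub_smul, Finset.sum_sub_distrib, ite_smul,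
      zero_smul, Finset.sum_ite_eq', Finset.mem_univ, if_true, Finset.sum_smul, mul_smul]
  have hli : LinearIndependent R v := by
    refine Fintype.linearIndependent_iff.mpr fun c hc => ?_
    have h1 := hsum c
    rw [hc, map_zero] at h1
    have h2 := Fintype.linearIndependent_iff.mp b.linearIndependent _ h1.symm
    have h3 : ∀ i, i ≠ i₀ → c i = 0 := fun i hi => by simpa [hi] using h2 i
    intro i
    by_cases hi : i = i₀
    · subst hi
      have h4 : ∑ j, c j * g j = 0 := Finset.sum_eq_zero fun j _ => by
        by_cases hj : j = i
        · rw [hj, hg, mul_zero]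
        · rw [h3 j hj, zero_mul]
      have h5 := h2 i
      simp only [if_true, h4, sub_zero] at h5
      exact (mul_eq_zero.mp h5).resolve_right ha
    · exact h3 i hi
  have hspan : ⊤ ≤ Submodule.span R (Set.range v) := by
    rintro x -
    obtain ⟨q, hq⟩ := hdvd (Submodule.inclusion hle x) x.2
    set f := b.repr (Submodule.inclusion hle x) with hf
    -- Rewriting b_i as v_i + g_i b_{i₀} for i ≠ i₀ leaves the coefficient f_{i₀} + ∑ f_j g_j on
    -- b_{i₀}; it equals aq, so v_{i₀} = a b_{i₀} gets coefficient q.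
    have hx : x = ∑ i, (if i = i₀ then q else f i) • v i := by
      refine Submodule.inclusion_injective hle ?_
      rw [hsum, ← b.sum_repr (Submodule.inclusion hle x)]
      refine Finset.sum_congr rfl fun i _ => ?_
      congr 1
      by_cases hi : i = i₀
      · have : ∑ j, (if j = i₀ then q else f j) * g j = ∑ j, f j * g j :=
          Finset.sum_congr rfl fun j _ => by
            by_cases hj : j = i₀
            · rw [hj, hg, mul_zero, mul_zero]
            · rw [if_neg hj]
        rw [this, hi, if_pos rfl, if_pos rfl, if_pos rfl]
        linear_combination hq
      · simp [hi, hf]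
    rw [hx]
    exact Submodule.sum_mem _ fun i _ =>
      Submodule.smul_mem _ _ (Submodule.subset_span ⟨i, rfl⟩)
  exact ⟨Module.Basis.mk hli hspan, fun i => by rw [Module.Basis.mk_apply]⟩

theorem add_sum_mul_eq_sum {R ι : Type*} [CommRing R] [Fintype ι] (i₀ : ι) {p q t : ι → R}
    (hq : q i₀ = 0) (ht : ∀ i, i ≠ i₀ → t i = q i * t i₀) :
    (p i₀ + ∑ j, p j * q j) * t i₀ = ∑ i, p i * t i := by
  classical
  rw [← Finset.add_sum_erase _ (fun j => p j * q j) (Finset.mem_univ i₀),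
    ← Finset.add_sum_erase _ (fun j => p j * t j) (Finset.mem_univ i₀), hq, mul_zero, zero_add,
    add_mul, Finset.sum_mul]
  congr 1
  exact Finset.sum_congr rfl fun j hj => by rw [ht j (Finset.ne_of_mem_erase hj), mul_assoc]

end Basis

/-! ### The addition theorem -/

section Addition

variable {K : Type v} [Field K]

theorem derivation_sum_apply {ι : Type u} {σ : Type*} (s : Finset σ)
    (θ : σ → Derivation K (MvPolynomial ι K) (MvPolynomial ι K)) (p : MvPolynomial ι K) :
    (∑ i ∈ s, θ i) p = ∑ i ∈ s, θ i p := by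
  classical
  induction s using Finset.induction_on with
  | empty => simp
  | insert a s ha ih => rw [Finset.sum_insert ha, Finset.sum_insert ha, Derivation.add_apply, ih]

theorem coe_sum_smul_apply {ι : Type u} {σ : Type*} {A : Set (Set (ι → K))} (s : Finset σ)
    (c : σ → MvPolynomial ι K) (b : σ → logDerivations A) (p : MvPolynomial ι K) :
    (∑ i ∈ s, c i • b i).1 p = ∑ i ∈ s, c i * (b i).1 p := by
  rw [AddSubmonoidClass.coe_finsetSum, derivation_sum_apply]
  rfl

theorem isHomogeneousDerivation_smul {ι : Type u}
    {θ : Derivation K (MvPolynomial ι K) (MvPolynomial ι K)} {d k : ℕ}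
    {p : MvPolynomial ι K} (hp : p.IsHomogeneous k) (hθ : IsHomogeneousDerivation θ d) :
    IsHomogeneousDerivation (p • θ) (k + d) := fun i => hp.mul (hθ i)

/-- The coefficients of a homogeneous derivation with respect to basis elements of larger degree
vanish. -/
theorem repr_eq_zero_of_degree_lt {ι : Type u} [Fintype ι] {A : Set (Set (ι → K))}
    (b : Module.Basis ι (MvPolynomial ι K) (logDerivations A)) {e : ι → ℕ}
    (hb : ∀ i, IsHomogeneousDerivation (b i).1 (e i)) {η : logDerivations A} {m : ℕ}
    (hη : IsHomogeneousDerivation η.1 m) {j : ι} (hj : m < e j) : b.repr η j = 0 := by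
  -- The degree-m part of the basis expansion is another expansion of η, in which basis elements of
  -- degree above m do not occur; coordinates are unique.
  have h : η = ∑ i, (if e i ≤ m then homogeneousComponent (m - e i) (b.repr η i) else 0) • b i := by
    refine Subtype.ext (derivation_ext fun k => ?_)
    have h1 : η.1 (X k) = ∑ i, b.repr η i * (b i).1 (X k) := by
      conv_lhs => rw [← b.sum_repr η, coe_sum_smul_apply]
    have h2 := congrArg (homogeneousComponent m) h1
    rw [homogeneousComponent_eq_self (hη k), map_sum] at h2
    rw [h2, coe_sum_smul_apply]
    refine Finset.sum_congr rfl fun i _ => ?_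
    rw [homogeneousComponent_mul_of_isHomogeneous (hb i k)]
    split_ifs
    · rfl
    · rw [zero_mul]
  rw [h, b.repr_sum_self, if_neg (by omega)]

theorem exists_eq_mul_of_isHomogeneous {κ : Type w} {B p : MvPolynomial κ K} {d m : ℕ}
    (hB : B.IsHomogeneous d) (hp : p.IsHomogeneous m) (h : B ∣ p) :
    (m < d → p = 0) ∧ ∃ g : MvPolynomial κ K, g.IsHomogeneous (m - d) ∧ p = g * B := by
  obtain ⟨q, rfl⟩ := h
  have h1 := homogeneousComponent_mul_of_isHomogeneous (p := q) hB m
  rw [mul_comm q B, homogeneousComponent_eq_self hp] at h1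
  split_ifs at h1 with hdm
  · exact ⟨fun h => absurd hdm (by omega), _, homogeneousComponent_isHomogeneous _ q, h1⟩
  · exact ⟨fun _ => h1, 0, isHomogeneous_zero _ _ _, by rw [h1, zero_mul]⟩

variable [CharZero K] {ι : Type u} {κ : Type w} [Fintype ι] [Fintype κ]

/-- Otherwise all basis elements of degree at most d lie in D(A) and restrict to logarithmic
derivations of A''. By degree, these restrictions lie in the span of the b'_j with e_j ≤ d. They are
also linearly independent, which contradicts the strict inequality of cardinalities. -/
theorem exists_degree_le_of_card_lt {A : Set (Set (ι → K))}
    (hA : IsCentralArrangement A)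
    {α : (ι → K) →ₗ[K] K} (hα : α ≠ 0) (hαA : {x | α x = 0} ∈ A) {φ : (κ → K) →ₗ[K] (ι → K)}
    (hφ : Function.Injective φ) (hr : Set.range φ = {x | α x = 0})
    (b : Module.Basis ι (MvPolynomial ι K) (logDerivations (A \ {{x | α x = 0}}))) {deg : ι → ℕ}
    (hb : ∀ i, IsHomogeneousDerivation (b i).1 (deg i))
    (b' : Module.Basis κ (MvPolynomial κ K)
      (logDerivations ((fun Y : Set (ι → K) => φ ⁻¹' Y) '' (A \ {{x | α x = 0}})))) {e : κ → ℕ}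
    (hb' : ∀ i, IsHomogeneousDerivation (b' i).1 (e i)) {d : ℕ}
    (hcard : Fintype.card {j // e j ≤ d} < Fintype.card {i // deg i ≤ d}) :
    ∃ i, deg i ≤ d ∧ pullback φ ((b i).1 (linearPolynomial α)) ≠ 0 := by
  by_contra! hcon
  obtain ⟨ψ, hψ⟩ := LinearMap.exists_leftInverse_of_injective φ (LinearMap.ker_eq_bot.mpr hφ)
  have hmem : ∀ i : {i // deg i ≤ d}, (b i).1 ∈ logDerivations A := fun i =>
    (mem_logDerivations_iff_pullback hA hα hαA hφ hr (b i).2).mpr (hcon i.1 i.2)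
  set ρ : {i // deg i ≤ d} →
      logDerivations ((fun Y : Set (ι → K) => φ ⁻¹' Y) '' (A \ {{x | α x = 0}})) := fun i =>
    ⟨restrictDerivation φ ψ hψ (b i).1, restrictDerivation_mem hA hα hαA hφ hr hψ (hmem i)⟩ with hρ
  have hrepr : ∀ i j, d < e j → b'.repr (ρ i) j = 0 := fun i j hj =>
    repr_eq_zero_of_degree_lt b' hb' (isHomogeneousDerivation_restrictDerivation hψ (hb i))
      (lt_of_le_of_lt i.2 hj)
  have hindep : ∀ g : {i // deg i ≤ d} → MvPolynomial κ K, ∑ i, g i • ρ i = 0 → g = 0 := by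
    intro g hg
    -- A relation on H is lifted along ψ to a combination θ of the b_i that restricts to zero, so θ
    -- = αη with η in D(A'). Comparing coordinates, α divides every lifted coefficient, and
    -- restricting to H kills them all.
    set θ : logDerivations (A \ {{x | α x = 0}}) := ∑ i, pullback ψ (g i) • b i.1 with hθ
    have hθval : ∀ p, θ.1 p = ∑ i, pullback ψ (g i) * (b i.1).1 p := fun p => by
      rw [hθ, coe_sum_smul_apply]
    have hθα : pullback φ (θ.1 (linearPolynomial α)) = 0 := by
      rw [hθval, map_sum]
      refine Finset.sum_eq_zero fun i _ => ?_
      rw [map_mul, hcon i.1 i.2, mul_zero]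
    have hθ0 : restrictDerivation φ ψ hψ θ.1 = 0 := by
      refine derivation_ext fun j => ?_
      have hg' := congrArg (fun η => η.1 (X j)) hg
      simp only [coe_sum_smul_apply, hρ, restrictDerivation_apply, ZeroMemClass.coe_zero] at hg'
      rw [restrictDerivation_apply, hθval, map_sum]
      simp only [map_mul, pullback_pullback_of_leftInverse hψ]
      exact hg'
    obtain ⟨η, hη, hθη⟩ :=
      exists_eq_smul_of_restrictDerivation_eq_zero hA hα hφ hr hψ θ.2 hθα hθ0
    have hθη' : θ = linearPolynomial α • (⟨η, hη⟩ : logDerivations (A \ {{x | α x = 0}})) :=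
      Subtype.ext hθη
    funext i
    have h1 := congrArg (fun η => b.repr η i.1) hθη'
    have h2 : b.repr θ i.1 = pullback ψ (g i) := by
      rw [hθ]
      simp only [map_sum, map_smul, Finsupp.coe_finsetSum, Finset.sum_apply,
        Module.Basis.repr_self, Finsupp.smul_apply]
      rw [Finset.sum_eq_single i]
      · simp
      · intro k _ hk
        rw [Finsupp.single_eq_of_ne (fun h => hk (Subtype.ext h.symm)), smul_zero]
      · simp
    simp only [h2, map_smul, Finsupp.smul_apply, smul_eq_mul] at h1
    have h3 := congrArg (pullback φ) h1
    rwa [pullback_pullback_of_leftInverse hψ, map_mul,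
      (dvd_iff_pullback_eq_zero hφ hα hr _).mp dvd_rfl, zero_mul] at h3
  refine absurd hcard (not_lt.mpr ?_)
  refine card_le_of_injective (MvPolynomial κ K)
    ({ toFun := fun g j => ∑ i, g i * b'.repr (ρ i) j.1
       map_add' := fun g g' => ?_
       map_smul' := fun c g => ?_ } : ({i // deg i ≤ d} → MvPolynomial κ K) →ₗ[MvPolynomial κ K]
        ({j // e j ≤ d} → MvPolynomial κ K)) ?_
  · funext j
    simp [add_mul, Finset.sum_add_distrib]
  · funext j
    simp [Finset.mul_sum, mul_assoc]
  · rw [← LinearMap.ker_eq_bot, LinearMap.ker_eq_bot']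
    intro g hg
    refine hindep g (b'.repr.injective (Finsupp.ext fun j => ?_))
    simp only [map_sum, map_smul, Finsupp.coe_finsetSum, Finset.sum_apply, Finsupp.smul_apply,
      smul_eq_mul, map_zero, Finsupp.coe_zero, Pi.zero_apply]
    by_cases hj : e j ≤ d
    · exact congrFun hg ⟨j, hj⟩
    · exact Finset.sum_eq_zero fun i _ => by rw [hrepr i j (not_le.mp hj), mul_zero]

/-- Some basis element of `D(A \ {H})` generates the restrictions of all `θ(α_H)` to `H`. -/
theorem exists_coefficients {A : Set (Set (ι → K))} (hA : IsCentralArrangement A)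
    {α : (ι → K) →ₗ[K] K} (hα : α ≠ 0) (hH : {x | α x = 0} ∈ A) {φ : (κ → K) →ₗ[K] (ι → K)}
    (hφ : Function.Injective φ) (hr : Set.range φ = {x | α x = 0})
    (b : Module.Basis ι (MvPolynomial ι K) (logDerivations (A \ {{x | α x = 0}}))) {deg : ι → ℕ}
    (hb : ∀ i, IsHomogeneousDerivation (b i).1 (deg i))
    (b' : Module.Basis κ (MvPolynomial κ K)
      (logDerivations ((fun Y : Set (ι → K) => φ ⁻¹' Y) '' (A \ {{x | α x = 0}})))) {deg' : κ → ℕ}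
    (hb' : ∀ i, IsHomogeneousDerivation (b' i).1 (deg' i)) {e : Multiset ℕ} {d : ℕ}
    (hdeg : (Finset.univ : Finset ι).val.map deg = d ::ₘ e)
    (hdeg' : (Finset.univ : Finset κ).val.map deg' = e)
    (hcard : (A \ {{x | α x = 0}}).ncard =
      ((fun Y : Set (ι → K) => φ ⁻¹' Y) '' (A \ {{x | α x = 0}})).ncard + d) :
    ∃ (i₀ : ι) (g : ι → MvPolynomial ι K), deg i₀ = d ∧
      pullback φ ((b i₀).1 (linearPolynomial α)) ≠ 0 ∧ g i₀ = 0 ∧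
      (∀ i, IsHomogeneousDerivation (g i • (b i₀).1) (deg i)) ∧
      ∀ i, i ≠ i₀ → pullback φ ((b i).1 (linearPolynomial α)) =
        pullback φ (g i) * pullback φ ((b i₀).1 (linearPolynomial α)) := by
  classical
  obtain ⟨B, hB0, hBd, hB⟩ := exists_dvd_pullback hA hα hφ hr hcard
  obtain ⟨ψ, hψ⟩ := LinearMap.exists_leftInverse_of_injective φ (LinearMap.ker_eq_bot.mpr hφ)
  -- The two degree lists differ only by the extra entry d, which is counted by the condition ≤ d.
  have hlt : Fintype.card {j // deg' j ≤ d} < Fintype.card {i // deg i ≤ d} := by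
    rw [Fintype.card_subtype, Fintype.card_subtype, Finset.card_def, Finset.card_def,
      Finset.filter_val, Finset.filter_val, ← Multiset.countP_eq_card_filter,
      ← Multiset.countP_eq_card_filter]
    have h1 := Multiset.countP_map deg Finset.univ.val (· ≤ d)
    have h2 := Multiset.countP_map deg' Finset.univ.val (· ≤ d)
    rw [hdeg, Multiset.countP_cons_of_pos (p := (· ≤ d)) _ le_rfl, ← Multiset.countP_eq_card_filter] at h1
    rw [hdeg', ← Multiset.countP_eq_card_filter] at h2
    omega
  obtain ⟨i₀, hi₀, hne⟩ := exists_degree_le_of_card_lt hA hα hH hφ hr b hb b' hb' hlt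
  have hhom : ∀ i, (pullback φ ((b i).1 (linearPolynomial α))).IsHomogeneous (deg i) := fun i =>
    isHomogeneous_pullback _ (isHomogeneousDerivation_apply_linearPolynomial (hb i) _)
  have hquot := fun i => exists_eq_mul_of_isHomogeneous hBd (hhom i) (hB _ (b i).2)
  -- A nonzero multiple of B has degree at least d, so the bound deg i₀ ≤ d is an equality and the
  -- quotient by B is a constant.
  have hi₀d : deg i₀ = d := le_antisymm hi₀ (not_lt.mp fun h => hne ((hquot i₀).1 h))
  obtain ⟨c, hc0, hc⟩ : ∃ c : K, c ≠ 0 ∧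
      pullback φ ((b i₀).1 (linearPolynomial α)) = C c * B := by
    obtain ⟨g, hg, hgB⟩ := (hquot i₀).2
    rw [hi₀d, Nat.sub_self] at hg
    have hg' : g = C (coeff 0 g) := by
      rw [← homogeneousComponent_zero, homogeneousComponent_eq_self hg]
    refine ⟨coeff 0 g, fun h => hne ?_, hg' ▸ hgB⟩
    rw [hgB, hg', h, C_0, zero_mul]
  have hcoef : ∀ i, ∃ g : MvPolynomial ι K, (i = i₀ → g = 0) ∧
      IsHomogeneousDerivation (g • (b i₀).1) (deg i) ∧
      (i ≠ i₀ → pullback φ ((b i).1 (linearPolynomial α)) =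
        pullback φ g * pullback φ ((b i₀).1 (linearPolynomial α))) := fun i => by
    -- For deg i < d divisibility by B already forces the restriction to vanish, so the coefficient
    -- is 0. This also keeps the subtraction deg i - d in the other case honest.
    by_cases hi : i = i₀ ∨ deg i < d
    · refine ⟨0, fun _ => rfl, fun k => ?_, fun hne => ?_⟩
      · rw [zero_smul]
        exact isHomogeneous_zero _ _ _
      · rw [(hquot i).1 (hi.resolve_left hne), map_zero, zero_mul]
    · push Not at hi
      obtain ⟨g, hg, hgB⟩ := (hquot i).2
      refine ⟨pullback ψ (C c⁻¹ * g), fun h => absurd h hi.1, ?_, fun _ => ?_⟩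
      · have := isHomogeneousDerivation_smul (isHomogeneous_pullback ψ (hg.C_mul c⁻¹)) (hb i₀)
        rwa [hi₀d, Nat.sub_add_cancel hi.2] at this
      · rw [pullback_pullback_of_leftInverse hψ, hc, hgB]
        have : (C c⁻¹ * C c : MvPolynomial κ K) = 1 := by
          rw [← C_mul, inv_mul_cancel₀ hc0, C_1]
        linear_combination (-g * B) * this
  choose g hg0 hghom hgα using hcoef
  exact ⟨i₀, g, hi₀d, hne, hg0 i₀ rfl, hghom, hgα⟩

/-- The addition theorem. -/
theorem IsFreeWithExponents.addition {A : Set (Set (ι → K))} (hA : IsCentralArrangement A)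
    {H : Set (ι → K)} (hH : H ∈ A) {φ : (κ → K) →ₗ[K] (ι → K)}
    (hφ : Function.Injective φ) (hr : Set.range φ = H) {e : Multiset ℕ} {d : ℕ}
    (hdel : IsFreeWithExponents (A \ {H}) (d ::ₘ e))
    (hres : IsFreeWithExponents ((fun Y : Set (ι → K) => φ ⁻¹' Y) '' restriction A H) e)
    (hcard : (A \ {H}).ncard =
      ((fun Y : Set (ι → K) => φ ⁻¹' Y) '' restriction A H).ncard + d) :
    IsFreeWithExponents A ((d + 1) ::ₘ e) := by
  classical
  rw [image_restriction_eq hA hH hr] at hres hcard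
  obtain ⟨α, hα, rfl⟩ := hA.exists_form hH
  obtain ⟨b, deg, hb, hdeg⟩ := hdel
  obtain ⟨b', deg', hb', hdeg'⟩ := hres
  obtain ⟨i₀, g, hi₀d, hne, hg0, hghom, hgα⟩ :=
    exists_coefficients hA hα hH hφ hr b hb b' hb' hdeg hdeg' hcard
  have hαφ : pullback φ (linearPolynomial α) = 0 :=
    (dvd_iff_pullback_eq_zero hφ hα hr _).mp dvd_rfl
  have hm₀ : linearPolynomial α • (b i₀).1 ∈ logDerivations A := by
    rw [mem_logDerivations_iff_pullback hA hα hH hφ hr (Submodule.smul_mem _ _ (b i₀).2),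
      Derivation.smul_apply, smul_eq_mul, map_mul, hαφ, zero_mul]
  have hm : ∀ i, i ≠ i₀ → (b i).1 - g i • (b i₀).1 ∈ logDerivations A := by
    intro i hi
    rw [mem_logDerivations_iff_pullback hA hα hH hφ hr
      (Submodule.sub_mem _ (b i).2 (Submodule.smul_mem _ _ (b i₀).2)), Derivation.sub_apply,
      Derivation.smul_apply, smul_eq_mul, map_sub, map_mul, hgα i hi, sub_self]
  have hd : ∀ θ : logDerivations (A \ {{x | α x = 0}}), θ.1 ∈ logDerivations A →
      linearPolynomial α ∣ b.repr θ i₀ + ∑ j, b.repr θ j * g j := by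
    intro θ hθ
    set f := b.repr θ with hf
    have hfsum : θ.1 (linearPolynomial α) = ∑ i, f i * (b i).1 (linearPolynomial α) := by
      conv_lhs => rw [← b.sum_repr θ, coe_sum_smul_apply]
    have hθα := (mem_logDerivations_iff_pullback hA hα hH hφ hr θ.2).mp hθ
    rw [dvd_iff_pullback_eq_zero hφ hα hr]
    -- The restriction of θ(α) is the restricted value for b_{i₀} times the i₀-coordinate of the
    -- changed basis; θ(α) vanishes on H and that value does not, so the coordinate is divisible by
    -- α.
    have h1 : pullback φ (f i₀ + ∑ j, f j * g j) *
        pullback φ ((b i₀).1 (linearPolynomial α)) = 0 := by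
      rw [← hθα, hfsum, map_add, map_sum, map_sum]
      simp only [map_mul]
      exact add_sum_mul_eq_sum i₀ (p := fun i => pullback φ (f i))
        (q := fun i => pullback φ (g i))
        (t := fun i => pullback φ ((b i).1 (linearPolynomial α)))
        (by rw [hg0, map_zero]) hgα
    exact (mul_eq_zero.mp h1).resolve_right hne
  obtain ⟨B', hB'⟩ := exists_basis_of_dvd
    (fun θ hθ H hH => hθ H hH.1 : logDerivations A ≤ logDerivations (A \ {{x | α x = 0}}))
    b i₀ (linearPolynomial_ne_zero hα) hg0 hm₀ hm hd
  refine ⟨B', fun i => if i = i₀ then d + 1 else deg i, fun i => ?_, ?_⟩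
  · rw [hB']
    dsimp only
    split_ifs with hi
    · have h1 := isHomogeneousDerivation_smul (isHomogeneous_linearPolynomial α) (hb i₀)
      rwa [hi₀d, add_comm] at h1
    · exact fun k => (hb i k).sub (hghom i k)
  · have huniv : (Finset.univ : Finset ι).val = i₀ ::ₘ (Finset.univ.erase i₀).val := by
      rw [Finset.erase_val, Multiset.cons_erase (Finset.mem_univ_val i₀)]
    rw [huniv, Multiset.map_cons] at hdeg ⊢
    rw [hi₀d, Multiset.cons_inj_right] at hdeg
    rw [if_pos rfl, ← hdeg]
    congr 1
    exact Multiset.map_congr rfl fun i hi => if_neg (Finset.ne_of_mem_erase hi)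

end Addition

/-! ### Inductive freeness with exponents, and the empty arrangement -/

section Classes

variable {K : Type v} [Field K]

/-- `A` is an inductively free central arrangement with multiset of exponents `e`, and the sum of
its exponents is the number of its hyperplanes. -/
structure IsInductivelyFreeWith {ι : Type u} [Fintype ι] (A : Set (Set (ι → K)))
    (e : Multiset ℕ) : Prop where
  central : IsCentralArrangement A
  exponents : IsFreeWithExponents A e
  inductively : IsInductivelyFree A
  ncard_eq : A.ncard = e.sum

theorem IsInductivelyFreeWith.isFree {ι : Type u} [Fintype ι] {A : Set (Set (ι → K))}
    {e : Multiset ℕ} (h : IsInductivelyFreeWith A e) : IsFree A := by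
  obtain ⟨b, -⟩ := h.exponents
  exact Module.Free.of_basis b

/-- The derivations of a polynomial ring form a free module. -/
noncomputable def derivationEquiv {ι : Type u} :
    (ι → MvPolynomial ι K) ≃ₗ[MvPolynomial ι K]
      Derivation K (MvPolynomial ι K) (MvPolynomial ι K) where
  toFun := mkDerivation K
  invFun := fun θ i => θ (X i)
  map_add' := fun f g => derivation_ext fun i => by simp
  map_smul' := fun c f => derivation_ext fun i => by simp
  left_inv := fun f => funext fun i => mkDerivation_X _ _ _
  right_inv := fun θ => derivation_ext fun i => mkDerivation_X _ _ _

theorem isFreeWithExponents_empty {ι : Type u} [Fintype ι] :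
    IsFreeWithExponents (∅ : Set (Set (ι → K))) (Multiset.replicate (Fintype.card ι) 0) := by
  classical
  have htop : logDerivations (∅ : Set (Set (ι → K))) = ⊤ :=
    eq_top_iff.mpr fun θ _ H hH => absurd hH (Set.notMem_empty H)
  refine ⟨(Pi.basisFun (MvPolynomial ι K) ι).map
    (derivationEquiv.trans (LinearEquiv.ofTop _ htop).symm), fun _ => 0, fun i j => ?_, ?_⟩
  · have : (mkDerivation K (Pi.single i (1 : MvPolynomial ι K)) (X j)).IsHomogeneous 0 := by
      rw [mkDerivation_X, Pi.single_apply]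
      split_ifs
      exacts [isHomogeneous_one _ _, isHomogeneous_zero _ _ _]
    simpa [derivationEquiv] using this
  · rw [Multiset.map_const', Finset.card_val, Finset.card_univ]

theorem isInductivelyFreeWith_empty [CharZero K] {ι : Type u} [Fintype ι] :
    IsInductivelyFreeWith (∅ : Set (Set (ι → K))) (Multiset.replicate (Fintype.card ι) 0) where
  central := isCentralArrangement_of_forms Set.finite_empty fun H hH => absurd hH (Set.notMem_empty H)
  exponents := isFreeWithExponents_empty
  inductively := .empty
  ncard_eq := by simp

/-- Carrying the equality of cardinality and exponent sum along supplies the cardinality condition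
of the addition theorem: the deletion has d + ∑e hyperplanes and the restriction ∑e. -/
theorem IsInductivelyFreeWith.addition [CharZero K] {ι κ : Type u} [Fintype ι] [Fintype κ]
    {A : Set (Set (ι → K))} (hA : IsCentralArrangement A) {H : Set (ι → K)} (hH : H ∈ A)
    {φ : (κ → K) →ₗ[K] (ι → K)} (hφ : Function.Injective φ) (hr : Set.range φ = H)
    {e : Multiset ℕ} {d : ℕ} (hdel : IsInductivelyFreeWith (A \ {H}) (d ::ₘ e))
    (hres : IsInductivelyFreeWith ((fun Y : Set (ι → K) => φ ⁻¹' Y) '' (A \ {H})) e) :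
    IsInductivelyFreeWith A ((d + 1) ::ₘ e) := by
  have hcard := hdel.ncard_eq
  rw [Multiset.sum_cons] at hcard
  rw [← image_restriction_eq hA hH hr] at hres
  refine ⟨hA, hdel.exponents.addition hA hH hφ hr hres.exponents ?_,
    .add A hA H hH φ hφ hr _ _ hdel.inductively hres.inductively hdel.exponents hres.exponents
      (Multiset.le_cons_self e d), ?_⟩
  · rw [hcard, hres.ncard_eq, add_comm]
  · rw [← Set.ncard_sdiff_singleton_add_one hH hA.finite, hcard, Multiset.sum_cons]
    ring

end Classes

/-! ### Cones over arrangements of hyperplanes x_i - x_j = c -/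

section Deformations

variable {K : Type v} [Field K] {V : Type u}

/-- The hyperplane `x_i - x_j = c z`. -/
def coneHyperplane (K : Type v) [Field K] {V : Type u} (i j : V) (c : ℤ) : Set (Option V → K) :=
  {y | y (some i) - y (some j) = c * y none}

/-- The hyperplane `z = 0`. -/
def hyperplaneAtInfinity (K : Type v) [Field K] (V : Type u) : Set (Option V → K) :=
  {y | y none = 0}

/-- The cone of the arrangement of all hyperplanes `x_i - x_j = c` with `R i j c`. -/
def coneDeformation (K : Type v) [Field K] {V : Type u} (R : V → V → ℤ → Prop) :
    Set (Set (Option V → K)) :=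
  {hyperplaneAtInfinity K V} ∪ {H | ∃ i j c, i ≠ j ∧ R i j c ∧ H = coneHyperplane K i j c}

/-- The linear form `x_i - x_j - c z`. -/
def coneForm (K : Type v) [Field K] {V : Type u} (i j : V) (c : ℤ) : (Option V → K) →ₗ[K] K :=
  (LinearMap.proj (some i) : (Option V → K) →ₗ[K] K) -
    LinearMap.proj (some j) - (c : K) • LinearMap.proj none

theorem coneHyperplane_eq (i j : V) (c : ℤ) :
    coneHyperplane K i j c = {y | coneForm K i j c y = 0} := by
  ext y
  simp [coneHyperplane, coneForm, sub_eq_zero]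

theorem coneHyperplane_swap (i j : V) (c : ℤ) :
    coneHyperplane K i j c = coneHyperplane K j i (-c) := by
  ext y
  simp only [coneHyperplane, Set.mem_ofPred_eq, Int.cast_neg]
  constructor <;> intro h <;> linear_combination -h

theorem coneForm_ne_zero {i j : V} (hij : i ≠ j) (c : ℤ) : coneForm K i j c ≠ 0 := by
  classical
  intro h
  have := congrArg (fun f => f (Pi.single (some i) 1)) h
  simp [coneForm, hij.symm] at this

theorem hyperplaneAtInfinity_ne {i j : V} (hij : i ≠ j) (c : ℤ) :
    hyperplaneAtInfinity K V ≠ coneHyperplane K i j c := by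
  classical
  intro h
  have := congrArg (fun s => Pi.single (some i) (1 : K) ∈ s) h
  simp [hyperplaneAtInfinity, coneHyperplane, hij.symm] at this

/-- The defining forms are proportional; comparing coefficients at x_i, x_j and z gives the factor 1
or -1. -/
theorem coneHyperplane_eq_iff [CharZero K] {i j a b : V} {c d : ℤ} (hij : i ≠ j) (hab : a ≠ b)
    (h : coneHyperplane K i j c = coneHyperplane K a b d) :
    (a = i ∧ b = j ∧ d = c) ∨ (a = j ∧ b = i ∧ d = -c) := by
  classical
  rw [coneHyperplane_eq, coneHyperplane_eq] at h
  obtain ⟨u, hu, huf⟩ := exists_eq_smul_of_setOf_eq (coneForm_ne_zero hij c)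
    (coneForm_ne_zero hab d) h
  have h1 := congrArg (fun f => f (Pi.single (some i) 1)) huf
  have h2 := congrArg (fun f => f (Pi.single (some j) 1)) huf
  have h3 := congrArg (fun f => f (Pi.single none 1)) huf
  simp only [coneForm, LinearMap.sub_apply, LinearMap.proj_apply, LinearMap.smul_apply,
    Pi.single_apply, Option.some.injEq, smul_eq_mul, reduceCtorEq, if_false, if_true, hij.symm,
    hij, mul_zero, mul_one, sub_zero, zero_sub] at h1 h2 h3
  by_cases hai : a = i
  · subst hai
    have hu1 : u = 1 := by simpa [hab.symm] using h1.symm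
    have hbj : b = j := by
      by_contra hbj
      simp [hbj, hij, hu1] at h2
    rw [hu1, one_mul, neg_inj] at h3
    exact Or.inl ⟨rfl, hbj, by exact_mod_cast h3⟩
  · have hbi : b = i := by
      by_contra hbi
      simp [hai, hbi] at h1
      exact hu h1.symm
    subst hbi
    have hu1 : u = -1 := by simpa [hab] using h1.symm
    have haj : a = j := by
      by_contra haj
      simp [haj, hij, hu1] at h2
    rw [hu1, neg_one_mul, neg_neg] at h3
    exact Or.inr ⟨haj, rfl, by
      have : (d : K) = ((-c : ℤ) : K) := by push_cast; linear_combination -h3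
      exact_mod_cast this⟩

/-- This degenerate case i = j occurs as the trace of a hyperplane parallel, before coning, to the
one restricted to. -/
theorem coneHyperplane_self [CharZero K] (a : V) {d : ℤ} (hd : d ≠ 0) :
    coneHyperplane K a a d = hyperplaneAtInfinity K V := by
  ext y
  have : (d : K) ≠ 0 := by exact_mod_cast hd
  simp [coneHyperplane, hyperplaneAtInfinity, this]

/-- The parametrization of the hyperplane `x_i = x_k + c z`. -/
def coneParam (K : Type v) [Field K] [DecidableEq V] {i k : V} (hki : k ≠ i) (c : ℤ) :
    (Option {j // j ≠ i} → K) →ₗ[K] (Option V → K) :=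
  LinearMap.pi fun o => match o with
    | none => LinearMap.proj none
    | some j => if h : j = i then LinearMap.proj (some ⟨k, hki⟩) + (c : K) • LinearMap.proj none
        else LinearMap.proj (some ⟨j, h⟩)

section Param

variable [DecidableEq V] {i k : V} (hki : k ≠ i) (c : ℤ)

@[simp]
theorem coneParam_none (y : Option {j // j ≠ i} → K) : coneParam K hki c y none = y none := rfl

@[simp]
theorem coneParam_some (y : Option {j // j ≠ i} → K) (j : {j // j ≠ i}) :
    coneParam K hki c y (some j.1) = y (some j) := by
  simp [coneParam, j.2]

@[simp]
theorem coneParam_self (y : Option {j // j ≠ i} → K) :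
    coneParam K hki c y (some i) = y (some ⟨k, hki⟩) + c * y none := by
  simp [coneParam]

theorem coneParam_injective : Function.Injective (coneParam K hki c) := by
  intro y y' h
  funext o
  cases o with
  | none => simpa using congrFun h none
  | some j => simpa using congrFun h (some j.1)

theorem range_coneParam : Set.range (coneParam K hki c) = coneHyperplane K i k c := by
  ext x
  constructor
  · rintro ⟨y, rfl⟩
    have := coneParam_some (K := K) hki c y ⟨k, hki⟩
    simp only [coneHyperplane, Set.mem_ofPred_eq, coneParam_self, coneParam_none]
    rw [this]
    ring
  · intro hx
    simp only [coneHyperplane, Set.mem_ofPred_eq] at hx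
    refine ⟨fun o => x (o.map Subtype.val), ?_⟩
    funext o
    cases o with
    | none => rfl
    | some j =>
      by_cases hj : j = i
      · subst hj
        rw [coneParam_self]
        simp only [Option.map_some, Option.map_none]
        linear_combination -hx
      · exact coneParam_some hki c _ ⟨j, hj⟩

theorem preimage_coneHyperplane (a b : {j // j ≠ i}) (d : ℤ) :
    coneParam K hki c ⁻¹' coneHyperplane K a.1 b.1 d = coneHyperplane K a b d := by
  ext y
  simp [coneHyperplane]

theorem preimage_coneHyperplane_left (b : {j // j ≠ i}) (d : ℤ) :
    coneParam K hki c ⁻¹' coneHyperplane K i b.1 d = coneHyperplane K ⟨k, hki⟩ b (d - c) := by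
  ext y
  simp only [coneHyperplane, Set.mem_preimage, Set.mem_ofPred_eq, coneParam_self, coneParam_some,
    coneParam_none, Int.cast_sub]
  constructor <;> intro h <;> linear_combination h

end Param

end Deformations

/-! ### Weighted arrangements: restriction, exponents and the induction -/

section Weighted

variable {K : Type v} [Field K] {V : Type u}

theorem coneDeformation_congr {R R' : V → V → ℤ → Prop}
    (h : ∀ i j c, i ≠ j → (R i j c ↔ R' i j c)) : coneDeformation K R = coneDeformation K R' := by
  unfold coneDeformation
  congr 1
  ext H
  constructor
  · rintro ⟨i, j, c, hij, hR, rfl⟩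
    exact ⟨i, j, c, hij, (h i j c hij).mp hR, rfl⟩
  · rintro ⟨i, j, c, hij, hR, rfl⟩
    exact ⟨i, j, c, hij, (h i j c hij).mpr hR, rfl⟩

theorem hyperplaneAtInfinity_mem (R : V → V → ℤ → Prop) :
    hyperplaneAtInfinity K V ∈ coneDeformation K R := Or.inl rfl

theorem coneHyperplane_mem {R : V → V → ℤ → Prop} {i j : V} {c : ℤ} (hij : i ≠ j) (h : R i j c) :
    coneHyperplane K i j c ∈ coneDeformation K R := Or.inr ⟨i, j, c, hij, h, rfl⟩

theorem isCentralArrangement_coneDeformation [CharZero K] [Fintype V] {R : V → V → ℤ → Prop}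
    {m : ℤ} (hR : ∀ i j c, R i j c → -m ≤ c ∧ c ≤ m) :
    IsCentralArrangement (coneDeformation K R) := by
  refine isCentralArrangement_of_forms ?_ ?_
  · refine (Set.finite_singleton _).union (Set.Finite.subset
      ((Set.toFinite (Set.univ ×ˢ Set.univ ×ˢ Set.Icc (-m) m)).image
        fun p : V × V × ℤ => coneHyperplane K p.1 p.2.1 p.2.2) ?_)
    rintro _ ⟨i, j, c, -, h, rfl⟩
    exact ⟨(i, j, c), ⟨trivial, trivial, hR i j c h⟩, rfl⟩
  · rintro H (rfl | ⟨i, j, c, hij, -, rfl⟩)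
    · refine ⟨LinearMap.proj none, fun h => ?_, rfl⟩
      have := congrArg (fun f => f fun _ => 1) h
      simp at this
    · exact ⟨coneForm K i j c, coneForm_ne_zero hij c, coneHyperplane_eq i j c⟩

/-- The relation that defines the arrangement with weights `n` on the vertex set `S`, together with
the hyperplanes `x_i - x_k = n_k + 1` for `i ∈ T`. -/
def WeightRel (S : Finset V) (n : V → ℤ) (k : V) (T : Finset V) (i j : V) (c : ℤ) : Prop :=
  i ∈ S ∧ j ∈ S ∧ ((-n i ≤ c ∧ c ≤ n j) ∨ (j = k ∧ i ∈ T ∧ c = n k + 1) ∨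
    (i = k ∧ j ∈ T ∧ c = -(n k + 1)))

/-- The cone of the arrangement `-n_i ≤ x_i - x_j ≤ n_j` on the vertex set `S`, together with the
hyperplanes `x_i - x_k = n_k + 1` for `i ∈ T`. -/
def weightedCone (K : Type v) [Field K] {V : Type u} (S : Finset V) (n : V → ℤ) (k : V)
    (T : Finset V) : Set (Set (Option V → K)) :=
  coneDeformation K (WeightRel S n k T)

theorem isCentralArrangement_weightedCone [CharZero K] [Fintype V] (S : Finset V) (n : V → ℤ)
    (k : V) (T : Finset V) : IsCentralArrangement (weightedCone K S n k T) := by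
  have hle : ∀ i, |n i| ≤ ∑ j, |n j| := fun i =>
    Finset.single_le_sum (f := fun j => |n j|) (fun j _ => abs_nonneg _) (Finset.mem_univ i)
  refine isCentralArrangement_coneDeformation (m := ∑ j, |n j| + 1) fun i j c h => ?_
  have hi := abs_le.mp (hle i)
  have hj := abs_le.mp (hle j)
  have hk := abs_le.mp (hle k)
  obtain ⟨-, -, h | ⟨-, -, rfl⟩ | ⟨-, -, rfl⟩⟩ := h <;> constructor <;> linarith

theorem weightedCone_empty_congr (S : Finset V) (n : V → ℤ) (k k' : V) :
    weightedCone K S n k ∅ = weightedCone K S n k' ∅ :=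
  coneDeformation_congr fun i j c hij => by simp [WeightRel]

/-- Base case: z = 0 is added to the empty arrangement, with d = 0. -/
theorem isInductivelyFreeWith_hyperplaneAtInfinity [CharZero K] [Fintype V] :
    IsInductivelyFreeWith (coneDeformation K fun _ _ _ => False : Set (Set (Option V → K)))
      (1 ::ₘ Multiset.replicate (Fintype.card V) 0) := by
  have hA : IsCentralArrangement
      (coneDeformation K fun _ _ _ => False : Set (Set (Option V → K))) :=
    isCentralArrangement_coneDeformation (m := 0) fun _ _ _ h => h.elim
  have hsdiff : (coneDeformation K fun _ _ _ => False : Set (Set (Option V → K))) \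
      {hyperplaneAtInfinity K V} = ∅ := by
    simp [coneDeformation]
  let φ : (V → K) →ₗ[K] (Option V → K) :=
    LinearMap.pi fun o => o.elim 0 LinearMap.proj
  refine IsInductivelyFreeWith.addition hA (hyperplaneAtInfinity_mem _) (φ := φ) ?_ ?_ ?_ ?_
  · intro x y h
    exact funext fun i => congrFun h (some i)
  · ext y
    constructor
    · rintro ⟨x, rfl⟩
      rfl
    · intro hy
      refine ⟨fun i => y (some i), funext fun o => ?_⟩
      cases o with
      | none => exact hy.symm
      | some i => rfl
  · rw [hsdiff, ← Multiset.replicate_succ, ← Fintype.card_option]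
    exact isInductivelyFreeWith_empty
  · rw [hsdiff, Set.image_empty]
    exact isInductivelyFreeWith_empty

theorem weightedCone_eq_of_forall {S : Finset V} {n : V → ℤ} {k : V} {R : V → V → ℤ → Prop}
    (h : ∀ i j c, i ≠ j → ((i ∈ S ∧ j ∈ S ∧ -n i ≤ c ∧ c ≤ n j) ↔ R i j c)) :
    weightedCone K S n k ∅ = coneDeformation K R :=
  coneDeformation_congr fun i j c hij => by simp [WeightRel, ← h i j c hij]

variable [DecidableEq V]

/-- The hyperplane is genuinely new: n_k + 1 lies just above the range for (i,k), equivalently -(n_k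
+ 1) lies just below the range for (k,i), and it is not among those indexed by T. -/
theorem weightedCone_insert_sdiff [CharZero K] {S : Finset V} {n : V → ℤ} {k : V} {T : Finset V}
    {i : V} (hi : i ∈ S) (hk : k ∈ S) (hiT : i ∉ T) (hki : k ≠ i) (hn : 0 ≤ n i) (hnk : -1 ≤ n k) :
    weightedCone K S n k (insert i T) \ {coneHyperplane K i k (n k + 1)} =
      weightedCone K S n k T := by
  ext H
  constructor
  · rintro ⟨rfl | ⟨a, b, d, hab, ⟨ha, hb, h⟩, rfl⟩, hne⟩
    · exact hyperplaneAtInfinity_mem _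
    · refine coneHyperplane_mem hab ⟨ha, hb, ?_⟩
      rcases h with h | ⟨rfl, h, rfl⟩ | ⟨rfl, h, rfl⟩
      · exact Or.inl h
      · refine Or.inr (Or.inl ⟨rfl, (Finset.mem_insert.mp h).resolve_left ?_, rfl⟩)
        rintro rfl
        exact hne rfl
      · refine Or.inr (Or.inr ⟨rfl, (Finset.mem_insert.mp h).resolve_left ?_, rfl⟩)
        rintro rfl
        refine hne ?_
        rw [Set.mem_singleton_iff, coneHyperplane_swap, neg_neg]
  · rintro (rfl | ⟨a, b, d, hab, ⟨ha, hb, h⟩, rfl⟩)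
    · exact ⟨hyperplaneAtInfinity_mem _, hyperplaneAtInfinity_ne hki.symm _⟩
    · refine ⟨coneHyperplane_mem hab ⟨ha, hb, ?_⟩, fun heq => ?_⟩
      · simp only [Finset.mem_insert]
        tauto
      · rcases coneHyperplane_eq_iff hab hki.symm heq with ⟨rfl, rfl, hd⟩ | ⟨rfl, rfl, hd⟩
        · rcases h with h | ⟨-, h, -⟩ | ⟨h, -, -⟩
          · omega
          · exact hiT h
          · exact hab h
        · rcases h with h | ⟨h, -, -⟩ | ⟨-, h, -⟩
          · omega
          · exact hki h.symm
          · exact hiT h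

/-- The weights of the restriction to `x_i = x_k + (n_k + 1) z`. -/
def restrictedWeight (n : V → ℤ) (i k : V) (j : {j // j ≠ i}) : ℤ :=
  n j.1 + if j.1 = k then n i + 1 else 0

/-- On H the hyperplanes x_i - x_b = dz become x_k - x_b = (d - n_k - 1)z with d - n_k - 1 from
-(n_i + n_k + 1) to n_b - n_k - 1. Since n_b ≥ 0 this interval and [-n_k, n_b] leave no gap, and
together they are [-(n_i + n_k + 1), n_b]. The hyperplanes indexed by T fall inside the enlarged
ranges because n_i ≥ 0, so T disappears. -/
theorem image_preimage_weightedCone [CharZero K] {S : Finset V} {n : V → ℤ} {k : V} {T : Finset V}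
    {i : V} (hi : i ∈ S) (hk : k ∈ S) (hiT : i ∉ T) (hki : k ≠ i)
    (hn : ∀ j ∈ S, j ≠ k → 0 ≤ n j) (hnk : -1 ≤ n k) :
    (fun Y => coneParam K hki (n k + 1) ⁻¹' Y) '' weightedCone K S n k T =
      weightedCone K (S.subtype (· ≠ i)) (restrictedWeight n i k) ⟨k, hki⟩ ∅ := by
  have hni := hn i hi hki.symm
  have hle : ∀ j, n j.1 ≤ restrictedWeight n i k j := fun j => by
    unfold restrictedWeight
    split_ifs <;> omega
  have hwk : restrictedWeight n i k ⟨k, hki⟩ = n i + n k + 1 := by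
    simp only [restrictedWeight, if_true]
    ring
  have hne : ∀ j : {j // j ≠ i}, j.1 ≠ k → restrictedWeight n i k j = n j.1 := fun j hj => by
    simp [restrictedWeight, hj]
  apply subset_antisymm
  · rintro _ ⟨_, rfl | ⟨a, b, d, hab, ⟨ha, hb, h⟩, rfl⟩, rfl⟩
    · exact hyperplaneAtInfinity_mem _
    have hleft : ∀ b d, b ∈ S → b ≠ i → -n i ≤ d → d ≤ n b →
        coneParam K hki (n k + 1) ⁻¹' coneHyperplane K i b d ∈
          weightedCone K (S.subtype (· ≠ i)) (restrictedWeight n i k) ⟨k, hki⟩ ∅ := by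
      intro b d hb hbi hd hd'
      rw [preimage_coneHyperplane_left hki _ ⟨b, hbi⟩]
      by_cases hbk : b = k
      · subst hbk
        -- Here d ≤ n_k < n_k + 1, so the shifted constant is nonzero and the trace is z = 0.
        rw [coneHyperplane_self _ (by omega)]
        exact hyperplaneAtInfinity_mem _
      · refine coneHyperplane_mem (fun h => hbk (congrArg Subtype.val h).symm)
          ⟨by simpa using hk, by simpa using hb, Or.inl ?_⟩
        have h1 : restrictedWeight n i k ⟨b, hbi⟩ = n b := hne ⟨b, hbi⟩ hbk
        have := hn b hb hbk
        rw [hwk, h1]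
        constructor <;> omega
    dsimp only
    by_cases hai : a = i
    · subst hai
      rcases h with h | ⟨-, h, -⟩ | ⟨h, -, -⟩
      · exact hleft b d hb hab.symm h.1 h.2
      · exact absurd h hiT
      · exact absurd h.symm hki
    by_cases hbi : b = i
    · subst hbi
      rcases h with h | ⟨h, -, -⟩ | ⟨-, h, -⟩
      · rw [coneHyperplane_swap]
        exact hleft a (-d) ha hab (by omega) (by omega)
      · exact absurd h.symm hki
      · exact absurd h hiT
    rw [preimage_coneHyperplane hki _ ⟨a, hai⟩ ⟨b, hbi⟩]
    refine coneHyperplane_mem (fun h => hab (congrArg Subtype.val h))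
      ⟨by simpa using ha, by simpa using hb, Or.inl ?_⟩
    have hla := hle ⟨a, hai⟩
    have hlb := hle ⟨b, hbi⟩
    dsimp only at hla hlb
    rcases h with h | ⟨rfl, -, rfl⟩ | ⟨rfl, -, rfl⟩
    · omega
    · have := hn a ha hab
      omega
    · have := hn b hb hab.symm
      omega
  · rintro _ (rfl | ⟨⟨a, hai⟩, ⟨b, hbi⟩, d, hab, ⟨ha, hb, h⟩, rfl⟩)
    · exact ⟨_, hyperplaneAtInfinity_mem _, rfl⟩
    have hab' : a ≠ b := fun h => hab (Subtype.ext h)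
    rw [Finset.mem_subtype] at ha hb
    replace h := h.resolve_right (by simp)
    have hleft : ∀ b (hbi : b ≠ i) d, b ∈ S → b ≠ k → -(n i + n k + 1) ≤ d → d ≤ n b →
        coneHyperplane K ⟨k, hki⟩ ⟨b, hbi⟩ d ∈
          (fun Y => coneParam K hki (n k + 1) ⁻¹' Y) '' weightedCone K S n k T := by
      intro b hbi d hb hbk hd hd'
      have := hn b hb hbk
      -- Below this threshold the hyperplane comes from the pair (i,b); above it d ≥ n_b - n_k ≥
      -- -n_k, so it comes from (k,b).
      by_cases hdb : d ≤ n b - n k - 1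
      · refine ⟨coneHyperplane K i b (d + (n k + 1)), coneHyperplane_mem hbi.symm
          ⟨hi, hb, Or.inl ⟨by omega, by omega⟩⟩, ?_⟩
        dsimp only
        rw [preimage_coneHyperplane_left hki _ ⟨b, hbi⟩, add_sub_cancel_right]
      · exact ⟨coneHyperplane K k b d, coneHyperplane_mem hbk.symm
          ⟨hk, hb, Or.inl ⟨by omega, hd'⟩⟩, preimage_coneHyperplane hki _ ⟨k, hki⟩ ⟨b, hbi⟩ d⟩
    by_cases hak : a = k
    · subst hak
      rw [hwk, hne ⟨b, hbi⟩ hab'.symm] at h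
      exact hleft b hbi d hb hab'.symm h.1 h.2
    by_cases hbk : b = k
    · subst hbk
      rw [hwk, hne ⟨a, hai⟩ hab'] at h
      dsimp only at h
      rw [coneHyperplane_swap]
      exact hleft a hai (-d) ha hab' (by omega) (by omega)
    rw [hne ⟨a, hai⟩ hak, hne ⟨b, hbi⟩ hbk] at h
    exact ⟨coneHyperplane K a b d, coneHyperplane_mem hab' ⟨ha, hb, Or.inl h⟩,
      preimage_coneHyperplane hki _ ⟨a, hai⟩ ⟨b, hbi⟩ d⟩

theorem sum_restrictedWeight {S : Finset V} {n : V → ℤ} {i k : V} (hi : i ∈ S) (hk : k ∈ S)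
    (hki : k ≠ i) :
    ∑ j ∈ S.subtype (· ≠ i), restrictedWeight n i k j = ∑ j ∈ S, n j + 1 := by
  have hk' : k ∈ S.filter (· ≠ i) := Finset.mem_filter.mpr ⟨hk, hki⟩
  have h := Finset.sum_subtype_eq_sum_filter (s := S) (p := (· ≠ i))
    (fun j => n j + if j = k then n i + 1 else 0)
  refine h.trans ?_
  rw [Finset.sum_add_distrib, Finset.sum_ite_eq', if_pos hk', Finset.filter_ne',
    ← Finset.add_sum_erase S n hi]
  ring

theorem card_subtype_ne {S : Finset V} {i : V} (hi : i ∈ S) :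
    (S.subtype (· ≠ i)).card + 1 = S.card := by
  rw [Finset.card_subtype, Finset.filter_ne', Finset.card_erase_add_one hi]

/-- The multiset `{0^r, 1, M, M + 1, …, M + t - 1}`. -/
def weightExponents (r t M : ℕ) : Multiset ℕ :=
  1 ::ₘ (Multiset.replicate r 0 + (Multiset.range t).map (M + ·))

theorem weightExponents_succ (r t M : ℕ) :
    weightExponents r (t + 1) M = (M + t) ::ₘ weightExponents r t M := by
  rw [weightExponents, weightExponents, Multiset.range_succ, Multiset.map_cons, Multiset.add_cons,
    Multiset.cons_swap]

theorem weightExponents_succ' (r t M : ℕ) :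
    weightExponents r (t + 1) M = M ::ₘ weightExponents r t (M + 1) := by
  induction t with
  | zero =>
    rw [weightExponents_succ, weightExponents, weightExponents, Multiset.range_zero,
      Multiset.map_zero, Multiset.map_zero, add_zero]
  | succ t ih =>
    rw [weightExponents_succ, ih, weightExponents_succ, Multiset.cons_swap]
    congr 2
    ring

/-- Both sides are {0^(r+1), 1, 1, …, t}. It turns the exponents of the braid arrangement without
one vertex into the starting exponents, with M = 0, for that vertex at weight -1. -/
theorem weightExponents_succ_left (r t : ℕ) :
    weightExponents (r + 1) t 1 = weightExponents r (t + 1) 0 := by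
  rw [weightExponents_succ', weightExponents, weightExponents, Multiset.replicate_succ,
    Multiset.cons_add, Multiset.cons_swap]

/-- Increasing the weight of one vertex by one. -/
theorem isInductivelyFreeWith_update [CharZero K] [Fintype V] {t r M : ℕ}
    (IH : ∀ {V : Type u} [Fintype V] [DecidableEq V] (S : Finset V) (n : V → ℤ) (k : V) (M : ℕ),
      (∀ i ∈ S, 0 ≤ n i) → S.card = t + 1 → Fintype.card V = r + t → (M : ℤ) = ∑ i ∈ S, n i + 1 →
      IsInductivelyFreeWith (weightedCone K S n k ∅) (weightExponents r t M))
    {S : Finset V} {n : V → ℤ} {k : V} (hk : k ∈ S) (hn : ∀ j ∈ S, j ≠ k → 0 ≤ n j)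
    (hnk : -1 ≤ n k) (hS : S.card = t + 2) (hV : Fintype.card V = r + (t + 1))
    (hM : (M : ℤ) = ∑ i ∈ S, n i + 1)
    (h : IsInductivelyFreeWith (weightedCone K S n k ∅) (weightExponents r (t + 1) M)) :
    IsInductivelyFreeWith (weightedCone K S (Function.update n k (n k + 1)) k ∅)
      (weightExponents r (t + 1) (M + 1)) := by
  -- Every restriction has total weight ∑n + 1 on t + 1 vertices, so its exponents are those for M +
  -- 1 independently of T; each addition only raises the remaining exponent M + |T|.
  have key : ∀ T ⊆ S.erase k, IsInductivelyFreeWith (weightedCone K S n k T)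
      ((M + T.card) ::ₘ weightExponents r t (M + 1)) := by
    intro T
    induction T using Finset.induction_on with
    | empty =>
      intro _
      rwa [weightExponents_succ'] at h
    | insert i T hiT ih =>
      intro hT
      obtain ⟨hik, hi⟩ := Finset.mem_erase.mp (hT (Finset.mem_insert_self i T))
      have hT' := ih ((Finset.subset_insert i T).trans hT)
      have hsdiff := weightedCone_insert_sdiff (K := K) (T := T) hi hk hiT hik.symm
        (hn i hi hik) hnk
      rw [Finset.card_insert_of_notMem hiT, ← add_assoc]
      refine IsInductivelyFreeWith.addition (isCentralArrangement_weightedCone _ _ _ _)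
        (H := coneHyperplane K i k (n k + 1)) (coneHyperplane_mem hik
          ⟨hi, hk, Or.inr (Or.inl ⟨rfl, Finset.mem_insert_self i T, rfl⟩)⟩)
        (coneParam_injective hik.symm (n k + 1)) (range_coneParam _ _) ?_ ?_
      · rwa [hsdiff]
      · rw [hsdiff, image_preimage_weightedCone hi hk hiT hik.symm hn hnk]
        refine IH _ _ _ _ (fun j hj => ?_) ?_ ?_ ?_
        · rw [Finset.mem_subtype] at hj
          have := hn i hi hik
          unfold restrictedWeight
          split_ifs with hjk
          · rw [hjk]
            omega
          · have := hn _ hj hjk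
            omega
        · have := card_subtype_ne hi
          omega
        · rw [Fintype.card_subtype_compl, Fintype.card_subtype_eq, hV]
          omega
        · rw [sum_restrictedWeight hi hk hik.symm]
          push_cast
          rw [hM]
  have hlast := key _ subset_rfl
  rw [Finset.card_erase_of_mem hk, hS] at hlast
  -- At T = S∖{k} there are t + 1 new hyperplanes, so the exponent M + t + 1 closes the block M + 1,
  -- …, M + 1 + t.
  rw [weightExponents_succ, show M + 1 + t = M + (t + 2 - 1) by omega]
  convert hlast using 1
  -- The added constants extend each range at k by exactly one integer; n_k ≥ -1 and nonnegativity
  -- elsewhere keep that integer within the opposite bound.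
  refine coneDeformation_congr fun i j c hij => ?_
  simp only [WeightRel, Function.update_apply, Finset.notMem_empty, false_and, and_false, or_false,
    Finset.mem_erase]
  refine and_congr_right fun hi => and_congr_right fun hj => ?_
  by_cases hik : i = k
  · subst hik
    have := hn j hj hij.symm
    simp only [if_true, hij.symm, if_false, ne_eq, not_false_eq_true, true_and, hj, false_and,
      false_or]
    omega
  · by_cases hjk : j = k
    · subst hjk
      have := hn i hi hij
      simp only [if_true, hij, if_false, ne_eq, not_false_eq_true, true_and, hi, false_and,
        or_false]
      omega
    · simp [hik, hjk]

/-- Outer induction on |S| = t + 1, inner on M = ∑n + 1. The ambient dimension is r + t + 1; one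
zero exponent comes from translating all coordinates in S simultaneously, the other r - 1 from the
vertices outside S. -/
theorem isInductivelyFreeWith_weightedCone [CharZero K] (t : ℕ) {V : Type u} [Fintype V]
    [DecidableEq V] (S : Finset V) (n : V → ℤ) (k : V) (r M : ℕ) (hn : ∀ i ∈ S, 0 ≤ n i)
    (hS : S.card = t + 1) (hV : Fintype.card V = r + t) (hM : (M : ℤ) = ∑ i ∈ S, n i + 1) :
    IsInductivelyFreeWith (weightedCone K S n k ∅) (weightExponents r t M) := by
  induction t generalizing V r M with
  | zero =>
    obtain ⟨a, rfl⟩ := Finset.card_eq_one.mp hS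
    rw [weightedCone_eq_of_forall (R := fun _ _ _ => False) fun i j c hij => ?_, weightExponents,
      Multiset.range_zero, Multiset.map_zero, add_zero, show r = Fintype.card V by omega]
    · exact isInductivelyFreeWith_hyperplaneAtInfinity
    · rw [Finset.mem_singleton, Finset.mem_singleton]
      exact ⟨fun h => hij (h.1.trans h.2.1.symm), False.elim⟩
  | succ t ih =>
    have IH : ∀ {V : Type u} [Fintype V] [DecidableEq V] (S : Finset V) (n : V → ℤ) (k : V)
      (M : ℕ), (∀ i ∈ S, 0 ≤ n i) → S.card = t + 1 → Fintype.card V = r + t →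
      (M : ℤ) = ∑ i ∈ S, n i + 1 →
      IsInductivelyFreeWith (weightedCone K S n k ∅) (weightExponents r t M) :=
      fun S n k M => ih S n k r M
    induction M using Nat.strong_induction_on generalizing n k with
    | _ M ihM =>
    have hMpos : 0 ≤ ∑ i ∈ S, n i := Finset.sum_nonneg hn
    obtain ⟨N, rfl⟩ : ∃ N, M = N + 1 := ⟨M - 1, by omega⟩
    push_cast at hM
    by_cases h0 : ∃ i ∈ S, 0 < n i
    · obtain ⟨i, hi, hni⟩ := h0
      have hsum : ∑ j ∈ S, Function.update n i (n i - 1) j = ∑ j ∈ S, n j - 1 := by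
        rw [Finset.sum_update_of_mem hi, Finset.sdiff_singleton_eq_erase,
          ← Finset.add_sum_erase S n hi]
        ring
      have hnn : ∀ j ∈ S, 0 ≤ Function.update n i (n i - 1) j := fun j hj => by
        rw [Function.update_apply]
        have := hn j hj
        split_ifs <;> omega
      have hN : (N : ℤ) = ∑ j ∈ S, Function.update n i (n i - 1) j + 1 := by
        rw [hsum]
        omega
      have h := isInductivelyFreeWith_update IH hi (fun j hj _ => hnn j hj)
        (by have := hnn i hi; omega) hS hV hN (ihM N (by omega) _ i hnn hN)
      rw [weightedCone_empty_congr S n k i]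
      simpa using h
    · push Not at h0
      have hn0 : ∀ i ∈ S, n i = 0 := fun i hi => le_antisymm (h0 i hi) (hn i hi)
      obtain ⟨i, hi⟩ : S.Nonempty := Finset.card_pos.mp (by omega)
      have hN0 : N = 0 := by
        rw [Finset.sum_eq_zero hn0] at hM
        omega
      subst hN0
      have hsum : ∑ j ∈ S, Function.update n i (-1) j = -1 := by
        rw [Finset.sum_update_of_mem hi, Finset.sum_eq_zero, add_zero]
        exact fun j hj => hn0 j (Finset.mem_sdiff.mp hj).1
      -- Deleting i lowers t by one with the ambient space fixed, so r grows to r + 1; all weights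
      -- are 0, hence M = 1.
      have hstart := ih (S.erase i) (fun _ => 0) i (r + 1) 1 (fun _ _ => le_rfl)
        (by rw [Finset.card_erase_of_mem hi]; omega) (by omega) (by simp)
      rw [weightExponents_succ_left] at hstart
      -- With weight -1 at i and 0 elsewhere, the range for a pair containing i is 1 ≤ c ≤ 0 or 0 ≤
      -- c ≤ -1, so i carries no hyperplane.
      have heq : weightedCone K (S.erase i) (fun _ => 0) i ∅ =
          weightedCone K S (Function.update n i (-1)) i ∅ := by
        refine coneDeformation_congr fun a b c hab => ?_
        simp only [WeightRel, Function.update_apply, Finset.notMem_empty, false_and, and_false,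
          or_false, Finset.mem_erase]
        by_cases ha : a ∈ S <;> by_cases hb : b ∈ S <;> simp only [ha, hb, and_true, true_and,
          and_false, false_and]
        have := hn0 a ha
        have := hn0 b hb
        split_ifs with h1 h2 h2
        · exact absurd (h1.trans h2.symm) hab
        · simp only [h1, not_true, ne_eq, false_and, neg_neg, false_iff]
          omega
        · simp only [h2, not_true, ne_eq, false_and, and_false, false_iff]
          omega
        · simp only [h1, h2, ne_eq, not_false_eq_true, true_and]
          omega
      rw [heq] at hstart
      have h := isInductivelyFreeWith_update IH hi
        (fun j hj hji => by rw [Function.update_of_ne hji]; exact hn j hj)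
        (by rw [Function.update_self]) hS hV (by rw [hsum]; rfl) hstart
      rw [weightedCone_empty_congr S n k i]
      simpa [← hn0 i hi] using h

end Weighted

/-! ### Identifying the cone of the digraph arrangement -/

section Cone

variable {K : Type v} [Field K] {V : Type u}

theorem exists_form_sub {i j : V} (hij : i ≠ j) :
    ∃ f : (V → K) →ₗ[K] K, f ≠ 0 ∧ ∀ x, f x = x i - x j := by
  classical
  let f : (V → K) →ₗ[K] K := (LinearMap.proj i : (V → K) →ₗ[K] K) - LinearMap.proj j
  refine ⟨f, fun h => ?_, fun x => rfl⟩
  have h1 : f (Pi.single i 1) = 0 := by rw [h, LinearMap.zero_apply]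
  simp [f, hij.symm] at h1

theorem extendedCatalan_eq (m : ℕ) :
    extendedCatalan K V m = digraphArrangement K (fun _ => m) ⊥ := by
  simp [extendedCatalan, digraphArrangement, edgeIndicator]

theorem weightExponents_one_eq (t N : ℕ) :
    weightExponents 1 t (N + 1) =
      ({0, 1} : Multiset ℕ) + (Finset.Icc 1 t).val.map (fun k => N + k) := by
  have h : (Multiset.range t).map (N + 1 + ·) = (Finset.Icc 1 t).val.map (fun k => N + k) := by
    induction t with
    | zero => rfl
    | succ t ih =>
      rw [Multiset.range_succ, Multiset.map_cons, ih,
        ← Finset.insert_Icc_right_eq_Icc_add_one (by omega), Finset.insert_val_of_notMem (by simp),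
        Multiset.map_cons, add_right_comm, add_assoc]
  rw [weightExponents, h, Multiset.replicate_one, ← Multiset.cons_add, Multiset.pair_comm]
  rfl

variable [CharZero K] [Fintype V]

theorem cone_digraphArrangement_eq (n : V → ℕ) {G : Digraph V} (hG : ∀ i j, ¬ G.Adj i j) (k : V) :
    cone (digraphArrangement K n G) =
      weightedCone K Finset.univ (fun i => (n i : ℤ)) k ∅ := by
  classical
  have hcone : ∀ {i j : V} (_ : i ≠ j) (c : ℤ) (p : MvPolynomial V K),
      IsDefiningPolynomial p {x | x i - x j = (c : K)} →
      {y : Option V → K | eval (fun i => y (some i)) p + eval 0 p * (y none - 1) = 0} =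
        coneHyperplane K i j c := by
    intro i j hij c p hp
    obtain ⟨f, hf, hfx⟩ := exists_form_sub (K := K) hij
    simp only [← hfx] at hp
    obtain ⟨u, hu, rfl⟩ := (isDefiningPolynomial_iff hf (c : K) p).mp hp
    ext y
    -- For p = u(f - c) the coning recipe yields u(f - cz), so the choice of defining polynomial
    -- only contributes the nonzero factor u.
    have : eval (fun i => y (some i)) (C u * (linearPolynomial f - C (c : K))) +
        eval 0 (C u * (linearPolynomial f - C (c : K))) * (y none - 1) =
        u * (y (some i) - y (some j) - c * y none) := by
      simp only [map_mul, map_sub, eval_C, eval_linearPolynomial, hfx, Pi.zero_apply]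
      ring
    rw [Set.mem_ofPred_eq, this, coneHyperplane, Set.mem_ofPred_eq, mul_eq_zero, or_iff_right hu,
      sub_eq_zero]
  have hdef : ∀ {i j : V} (_ : i ≠ j) (c : ℤ), ∃ p : MvPolynomial V K,
      IsDefiningPolynomial p {x | x i - x j = (c : K)} := by
    intro i j hij c
    obtain ⟨f, hf, hfx⟩ := exists_form_sub (K := K) hij
    simp only [← hfx]
    exact ⟨_, (isDefiningPolynomial_iff hf (c : K) _).mpr ⟨1, one_ne_zero, rfl⟩⟩
  rw [weightedCone_eq_of_forall (R := fun i j c => -(n i : ℤ) ≤ c ∧ c ≤ n j)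
    fun i j c _ => by simp]
  unfold cone coneDeformation
  congr 1
  ext Y
  simp only [digraphArrangement, edgeIndicator, hG, if_false, sub_zero, add_zero]
  constructor
  · rintro ⟨_, ⟨i, j, c, hij, h, h', rfl⟩, p, hp, rfl⟩
    exact ⟨i, j, c, hij, ⟨h, h'⟩, hcone hij c p hp⟩
  · rintro ⟨i, j, c, hij, ⟨h, h'⟩, rfl⟩
    obtain ⟨p, hp⟩ := hdef hij c
    exact ⟨_, ⟨i, j, c, hij, h, h', rfl⟩, p, hp, (hcone hij c p hp).symm⟩

end Cone

end HyperplaneArrangement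

/-! ### The theorem: S is all of V, with r = 1, t = ℓ - 1 and M = |n| + 1 -/

theorem mainTheorem3 {K : Type*} [Field K] [CharZero K] {V : Type*} [Fintype V]
    (hV : 2 ≤ Fintype.card V) :
    (∀ (n : V → ℕ) (G : Digraph V), (∀ i j, ¬ G.Adj i j) →
      HyperplaneArrangement.IsFree
        (HyperplaneArrangement.cone (HyperplaneArrangement.digraphArrangement K n G)) ∧
      HyperplaneArrangement.IsFreeWithExponents
        (HyperplaneArrangement.cone (HyperplaneArrangement.digraphArrangement K n G))
        (({0, 1} : Multiset ℕ) +
          (Finset.Icc 1 (Fintype.card V - 1)).val.map (fun k => (∑ i, n i) + k)) ∧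
      HyperplaneArrangement.IsInductivelyFree
        (HyperplaneArrangement.cone (HyperplaneArrangement.digraphArrangement K n G))) ∧
    (∀ m : ℕ, HyperplaneArrangement.IsFree
      (HyperplaneArrangement.cone (HyperplaneArrangement.extendedCatalan K V m))) := by
  classical
  have key : ∀ (n : V → ℕ) (G : Digraph V), (∀ i j, ¬ G.Adj i j) →
      HyperplaneArrangement.IsInductivelyFreeWith
        (HyperplaneArrangement.cone (HyperplaneArrangement.digraphArrangement K n G))
        (({0, 1} : Multiset ℕ) +
          (Finset.Icc 1 (Fintype.card V - 1)).val.map (fun k => (∑ i, n i) + k)) := by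
    intro n G hG
    obtain ⟨k⟩ : Nonempty V := Fintype.card_pos_iff.mp (by omega)
    rw [HyperplaneArrangement.cone_digraphArrangement_eq n hG k,
      ← HyperplaneArrangement.weightExponents_one_eq]
    refine HyperplaneArrangement.isInductivelyFreeWith_weightedCone _ _ _ _ _ _
      (fun i _ => by positivity) ?_ ?_ ?_
    · rw [Finset.card_univ]
      omega
    · omega
    · push_cast
      rfl
  refine ⟨fun n G hG => ⟨(key n G hG).isFree, (key n G hG).exponents, (key n G hG).inductively⟩,
    fun m => ?_⟩
  rw [HyperplaneArrangement.extendedCatalan_eq]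
  exact (key _ _ (by simp)).isFree
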